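/- Let $V=V(u,x)$ be a smooth, compactly supported function on $\mathbb{R}\times\mathbb{R}^2$ that is radially symmetric in $x$, i.e. $V(u,x)$ depends only on $u$ and $|x|$. For a bounded domain $D\subset\mathbb{R}^2$ with smooth boundary put $$I_D(u)=\int_D \tfrac12|\nabla u|^2-V(u(x),x)\,dx .$$ If $V$ does not vanish identically, then there exists a smooth radial solution $u:\mathbb{R}^2\setminus\{0\}\to\mathbb{R}$ of $$\Delta u=-V'_u(u,x)$$ that is not minimal, and not even locally minimal. That is, there is a bounded domain $D$ with smooth boundary and $\overline D\subset\mathbb{R}^2\setminus\{0\}$ such that for every $k\ge 0$ and $\varepsilon>0$ there is a function $v$, smooth on a neighbourhood of $\overline D$, with $v=u$ on $\partial D$, with $|D^j(v-u)|<\varepsilon$ on $D$ for all $0\le j\le k$, and with $I_D(v)<I_D(u)$. -/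

import Mathlib

open scoped ContDiff Laplacian

namespace EllipticRigidity

/-- The Euclidean plane. -/
abbrev Plane : Type := EuclideanSpace ℝ (Fin 2)

/-- `D` is a bounded domain with smooth boundary: near each boundary point, `D` is the sublevel set
`{g < 0}` of a smooth function `g` whose differential does not vanish at that point. -/
structure IsSmoothBoundedDomain (D : Set Plane) : Prop where
  isOpen : IsOpen D
  isConnected : IsConnected D
  isBounded : Bornology.IsBounded D
  smooth_boundary : ∀ x ∈ frontier D, ∃ N : Set Plane, ∃ g : Plane → ℝ,
    IsOpen N ∧ x ∈ N ∧ ContDiffOn ℝ ∞ g N ∧ fderiv ℝ g x ≠ 0 ∧ D ∩ N = {y ∈ N | g y < 0}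

/-- The functional `I(u) = ∫_D ½ |∇u|² - V(u, x) dx`. -/
noncomputable def energy (V : ℝ → Plane → ℝ) (D : Set Plane) (u : Plane → ℝ) : ℝ :=
  ∫ x in D, ((1 / 2 : ℝ) * ‖gradient u x‖ ^ 2 - V (u x) x)

/-- `u` is a smooth classical solution of `Δu = -V'_u(u, x)` on the open set `Ω`. -/
def IsSolution (V : ℝ → Plane → ℝ) (Ω : Set Plane) (u : Plane → ℝ) : Prop :=
  ContDiffOn ℝ ∞ u Ω ∧ ∀ x ∈ Ω, (Δ u) x = -deriv (fun s => V s x) (u x)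

/-- `v` is smooth up to the boundary of `D` and has the same boundary values as `u`. -/
def IsCompetitor (D : Set Plane) (u v : Plane → ℝ) : Prop :=
  (∃ O : Set Plane, IsOpen O ∧ closure D ⊆ O ∧ ContDiffOn ℝ ∞ v O) ∧ ∀ x ∈ frontier D, v x = u x

/-- The function `u` on `Ω` is globally minimising: on every bounded subdomain with smooth boundary
it minimises the functional among all smooth functions with the same boundary values. -/
def IsGloballyMinimising (V : ℝ → Plane → ℝ) (Ω : Set Plane) (u : Plane → ℝ) : Prop :=
  ∀ D : Set Plane, IsSmoothBoundedDomain D → closure D ⊆ Ω →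
    ∀ v : Plane → ℝ, IsCompetitor D u v → energy V D u ≤ energy V D v

/-- The function `u` on `Ω` is locally minimal: on every bounded subdomain with smooth boundary it
minimises the functional among those smooth functions with the same boundary values that lie in some
`C^k`-neighbourhood of `u`. The order `k` may be chosen, so that this is the weakest local notion:
it follows from local minimality in the `C^0` and in the `C^1` topology. -/
def IsLocallyMinimal (V : ℝ → Plane → ℝ) (Ω : Set Plane) (u : Plane → ℝ) : Prop :=
  ∀ D : Set Plane, IsSmoothBoundedDomain D → closure D ⊆ Ω →
    ∃ k : ℕ, ∃ ε : ℝ, 0 < ε ∧ ∀ v : Plane → ℝ, IsCompetitor D u v →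
      (∀ j ≤ k, ∀ x ∈ D, ‖iteratedFDeriv ℝ j (fun y => v y - u y) x‖ < ε) →
        energy V D u ≤ energy V D v

end EllipticRigidity

namespace EllipticRigidity

open Set Filter Topology MeasureTheory NNReal

/-! In logarithmic time `t = log |x|` the radial equation becomes Newton's equation `w'' = -f(t, w)`
with `f = e^{2t} V'_u`. By conformal invariance of the Dirichlet integral in the plane, the energy
on an annulus is a constant multiple of the action of `w`. It is therefore enough to find one orbit
with negative second variation `∫ y'² - f_q(t, w) y²` for some compactly supported `y`.

Such an orbit is found by averaging over all orbits, as in E. Hopf's rigidity argument. A test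
function `φ` on the extended phase space of points `(t, q, p)` gives a variation `y = φ(orbit)`
along every orbit at once. By Liouville's theorem, if all these second variations were nonnegative,
then so would be `∫ (Xφ)² - f_q φ²`, where `X` is the Newton field
(`IsGlobalFlow.newton_integral_nonneg`).

This integral can be made negative. A wide plateau function `φ₀`, adapted to the free motion, makes
it at most `A / P` at scale `P` (`exists_integral_phaseCutoff_le`): integration by parts in `q`
replaces `f_q φ²` by `f φ φ_q`, and `f` is bounded in `q`-support and decays in `t`. Adding `ε f_q
β` inside the plateau, with `β` a bump, changes the integral by `-2ε ∫ f_q² β + O(ε²)`, a fixed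
negative amount for fixed small `ε`. Since `V ≢ 0` forces `f_q ≢ 0`, large `P` gives a negative
total (`exists_integral_indexDensity_neg`).

The perturbation `w + s y` then has smaller action for all small `s > 0`, and it tends to `w` in
every `C^k` on the annulus. -/

/-- `Ψ` is the global flow of the vector field `X`. -/
structure IsGlobalFlow {E : Type*} [NormedAddCommGroup E] [NormedSpace ℝ E]
    (X : E → E) (Ψ : ℝ → E → E) : Prop where
  zero : ∀ x, Ψ 0 x = x
  hasDerivAt : ∀ x s, HasDerivAt (fun τ => Ψ τ x) (X (Ψ s x)) s

/-! ### Global flows of Lipschitz vector fields -/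

section Flow

variable {E : Type*} [NormedAddCommGroup E] [NormedSpace ℝ E] {X : E → E} {K : ℝ≥0}

/-- The existence time depends on `K` alone: on the ball of radius `‖X x‖ + 1` the speed is at most
`K + 1` times that radius, so the size of `X x` cancels. A uniform existence time is what allows
local curves to be continued to all times. -/
theorem exists_integralCurveOn_uniform [CompleteSpace E] (hX : LipschitzWith K X) (x : E) :
    ∃ γ : ℝ → E, γ 0 = x ∧
      IsMIntegralCurveOn (I := modelWithCornersSelf ℝ E) γ X
        (Ioo (-(1 / (2 * ((K : ℝ) + 1)))) (1 / (2 * ((K : ℝ) + 1)))) := by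
  set ε : ℝ := 1 / (2 * ((K : ℝ) + 1)) with hε
  have hK : (0 : ℝ) ≤ K := K.2
  have hεpos : 0 < ε := by positivity
  have h0 : (0 : ℝ) ∈ Icc (-ε) ε := ⟨by linarith, hεpos.le⟩
  have hPL : IsPicardLindelof (fun _ : ℝ => X) (⟨0, h0⟩ : Icc (-ε) ε) x (‖X x‖₊ + 1) 0
      (‖X x‖₊ + K * (‖X x‖₊ + 1)) K := by
    refine ⟨fun t _ => hX.lipschitzOnWith, fun y _ => continuousOn_const, ?_, ?_⟩
    · intro t _ y hy
      have h1 : ‖X y - X x‖ ≤ K * ‖y - x‖ := by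
        simpa [dist_eq_norm] using hX.dist_le_mul y x
      have h2 : ‖y - x‖ ≤ ‖X x‖ + 1 := by
        simpa [dist_eq_norm] using hy
      have h3 : ‖X y‖ ≤ ‖X y - X x‖ + ‖X x‖ := by
        simpa using norm_add_le (X y - X x) (X x)
      push_cast
      have := mul_le_mul_of_nonneg_left h2 hK
      linarith
    · simp only [NNReal.coe_add, NNReal.coe_mul, coe_nnnorm, NNReal.coe_one, NNReal.coe_zero,
        sub_zero, zero_sub, neg_neg, max_self]
      rw [hε, mul_one_div, div_le_iff₀ (by positivity)]
      nlinarith [norm_nonneg (X x), mul_nonneg hK (norm_nonneg (X x))]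
  obtain ⟨γ, hγ0, hγ⟩ := hPL.exists_eq_forall_mem_Icc_hasDerivWithinAt₀
  refine ⟨γ, hγ0, fun t ht => ?_⟩
  have h := (hγ t (Ioo_subset_Icc_self ht)).hasDerivAt (Icc_mem_nhds ht.1 ht.2)
  exact (h.hasFDerivAt.hasMFDerivAt).hasMFDerivWithinAt

theorem exists_isGlobalFlow [CompleteSpace E] (hX : LipschitzWith K X) (hX' : ContDiff ℝ 1 X) :
    ∃ Ψ : ℝ → E → E, IsGlobalFlow X Ψ := by
  have hpos : (0 : ℝ) < 1 / (2 * ((K : ℝ) + 1)) := by positivity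
  have key : ∀ x : E, ∃ γ : ℝ → E, γ 0 = x ∧ ∀ s, HasDerivAt γ (X (γ s)) s := by
    intro x
    obtain ⟨γ, h0, hγ⟩ := exists_isMIntegralCurve_of_isMIntegralCurveOn
      (I := modelWithCornersSelf ℝ E) (v := X)
      (contMDiff_vectorSpace_iff_contDiff.2 hX') hpos
      (exists_integralCurveOn_uniform hX) x
    refine ⟨γ, h0, fun s => ?_⟩
    have h : HasFDerivAt γ (ContinuousLinearMap.smulRight (1 : ℝ →L[ℝ] ℝ) (X (γ s))) s :=
      (hγ s).hasFDerivAt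
    exact h.hasDerivAt.congr_deriv (by simp)
  choose γ h0 hγ using key
  exact ⟨fun s x => γ x s, ⟨h0, fun x s => hγ x s⟩⟩

/-- Grönwall's inequality, with negative times handled by reversing time. It yields uniqueness, the
group law and Lipschitz dependence on the initial point; differentiability in that point is never
needed. -/
theorem dist_integralCurve_le (hX : LipschitzWith K X) {γ δ : ℝ → E}
    (hγ : ∀ s, HasDerivAt γ (X (γ s)) s) (hδ : ∀ s, HasDerivAt δ (X (δ s)) s) (s : ℝ) :
    dist (γ s) (δ s) ≤ dist (γ 0) (δ 0) * Real.exp (K * |s|) := by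
  rcases le_total 0 s with hs | hs
  · have := dist_le_of_trajectories_ODE (v := fun _ => X) (K := K) (fun _ => hX)
      (fun t _ => (hγ t).continuousAt.continuousWithinAt) (fun t _ => (hγ t).hasDerivWithinAt)
      (fun t _ => (hδ t).continuousAt.continuousWithinAt) (fun t _ => (hδ t).hasDerivWithinAt)
      le_rfl s ⟨hs, le_rfl⟩
    simpa [abs_of_nonneg hs] using this
  · have hX' : LipschitzWith K (fun x => -X x) := hX.neg
    have hrev : ∀ {γ : ℝ → E}, (∀ s, HasDerivAt γ (X (γ s)) s) →
        ∀ s, HasDerivAt (fun τ => γ (-τ)) (-X (γ (-s))) s := by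
      intro γ hγ s
      simpa [Function.comp_def] using HasDerivAt.scomp s (hγ (-s)) (hasDerivAt_neg s)
    have := dist_le_of_trajectories_ODE (v := fun _ => fun x => -X x) (K := K) (fun _ => hX')
      (fun t _ => (hrev hγ t).continuousAt.continuousWithinAt)
      (fun t _ => (hrev hγ t).hasDerivWithinAt)
      (fun t _ => (hrev hδ t).continuousAt.continuousWithinAt)
      (fun t _ => (hrev hδ t).hasDerivWithinAt)
      le_rfl (-s) ⟨neg_nonneg.2 hs, le_rfl⟩
    simpa [abs_of_nonpos hs] using this

namespace IsGlobalFlow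

variable {Ψ : ℝ → E → E}

theorem dist_le (hΨ : IsGlobalFlow X Ψ) (hX : LipschitzWith K X) (s : ℝ) (x y : E) :
    dist (Ψ s x) (Ψ s y) ≤ dist x y * Real.exp (K * |s|) := by
  simpa [hΨ.zero] using dist_integralCurve_le hX (hΨ.hasDerivAt x) (hΨ.hasDerivAt y) s

theorem add (hΨ : IsGlobalFlow X Ψ) (hX : LipschitzWith K X) (s h : ℝ) (x : E) :
    Ψ (s + h) x = Ψ s (Ψ h x) := by
  have h1 : ∀ s, HasDerivAt (fun τ => Ψ (τ + h) x) (X (Ψ (s + h) x)) s := fun s =>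
    (hΨ.hasDerivAt x (s + h)).comp_add_const s h
  have := dist_integralCurve_le hX h1 (hΨ.hasDerivAt (Ψ h x)) s
  simp only [zero_add, hΨ.zero, dist_self, zero_mul] at this
  exact dist_le_zero.1 this

theorem neg_apply (hΨ : IsGlobalFlow X Ψ) (hX : LipschitzWith K X) (s : ℝ) (x : E) :
    Ψ (-s) (Ψ s x) = x := by
  rw [← hΨ.add hX, neg_add_cancel, hΨ.zero]

theorem lipschitzWith (hΨ : IsGlobalFlow X Ψ) (hX : LipschitzWith K X) (s : ℝ) :
    LipschitzWith (Real.toNNReal (Real.exp (K * |s|))) (Ψ s) :=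
  LipschitzWith.of_dist_le_mul fun x y => by
    rw [Real.coe_toNNReal _ (Real.exp_pos _).le, mul_comm]
    exact hΨ.dist_le hX s x y

theorem continuous_uncurry (hΨ : IsGlobalFlow X Ψ) (hX : LipschitzWith K X) :
    Continuous (fun z : ℝ × E => Ψ z.1 z.2) := by
  rw [continuous_iff_continuousAt]
  rintro ⟨s, x⟩
  rw [ContinuousAt, tendsto_iff_dist_tendsto_zero]
  have h1 : Tendsto (fun z : ℝ × E => dist z.2 x * Real.exp (K * |z.1|) + dist (Ψ z.1 x) (Ψ s x))
      (𝓝 (s, x)) (𝓝 (dist x x * Real.exp (K * |s|) + dist (Ψ s x) (Ψ s x))) := by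
    have hc : Continuous (fun τ => Ψ τ x) :=
      continuous_iff_continuousAt.2 fun τ => (hΨ.hasDerivAt x τ).continuousAt
    have : Continuous (fun z : ℝ × E =>
        dist z.2 x * Real.exp (K * |z.1|) + dist (Ψ z.1 x) (Ψ s x)) := by
      have := hc.comp (continuous_fst (X := ℝ) (Y := E))
      simp only [Function.comp_def] at this
      fun_prop
    exact this.tendsto (s, x)
  simp only [dist_self, zero_mul, add_zero] at h1
  refine squeeze_zero (fun _ => dist_nonneg) (fun z => ?_) h1
  exact (dist_triangle _ (Ψ z.1 x) _).trans (add_le_add_left (hΨ.dist_le hX _ _ _) _)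

/-- Bootstrapping: the derivative of the curve is `X` composed with the curve, so each order of
smoothness gives the next. -/
theorem contDiff_curve (hΨ : IsGlobalFlow X Ψ) (hX : ContDiff ℝ ∞ X) (x : E) :
    ContDiff ℝ ∞ (fun s => Ψ s x) := by
  have hd : Differentiable ℝ (fun s => Ψ s x) := fun s => (hΨ.hasDerivAt x s).differentiableAt
  have hderiv : deriv (fun s => Ψ s x) = fun s => X (Ψ s x) :=
    funext fun s => (hΨ.hasDerivAt x s).deriv
  rw [contDiff_infty]
  intro n
  induction n with
  | zero => exact contDiff_zero.2 hd.continuous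
  | succ n ih =>
    push_cast
    rw [contDiff_succ_iff_deriv]
    refine ⟨hd, by simp, ?_⟩
    rw [hderiv]
    exact (hX.of_le (by exact_mod_cast le_top)).comp ih

end IsGlobalFlow

end Flow

/-! ### Newton's equation and Liouville's theorem through the symplectic Euler scheme -/

/-- The phase space vector field of Newton's equation `q'' = -f(t, q)` in the extended
coordinates `(t, q, p)`. -/
def newtonField (f : ℝ × ℝ → ℝ) (x : ℝ × ℝ × ℝ) : ℝ × ℝ × ℝ := (1, x.2.2, -f (x.1, x.2.1))

/-- One step of the symplectic Euler scheme for Newton's equation. -/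
def eulerStep (f : ℝ × ℝ → ℝ) (h : ℝ) (x : ℝ × ℝ × ℝ) : ℝ × ℝ × ℝ :=
  (x.1 + h, x.2.1 + h * x.2.2, x.2.2 - h * f (x.1, x.2.1 + h * x.2.2))

section Newton

variable {f : ℝ × ℝ → ℝ} {K : ℝ≥0} {C : ℝ} {Ψ : ℝ → ℝ × ℝ × ℝ → ℝ × ℝ × ℝ}

theorem contDiff_newtonField (hf : ContDiff ℝ ∞ f) : ContDiff ℝ ∞ (newtonField f) := by
  unfold newtonField; fun_prop

theorem lipschitzWith_newtonField (hf : LipschitzWith K f) :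
    LipschitzWith (max 1 K) (newtonField f) := by
  have h1 : LipschitzWith 1 (fun x : ℝ × ℝ × ℝ => x.2.2) :=
    by simpa [Function.comp_def] using
      LipschitzWith.prod_snd.comp (LipschitzWith.prod_snd (α := ℝ) (β := ℝ × ℝ))
  have h2 : LipschitzWith 1 (fun x : ℝ × ℝ × ℝ => (x.1, x.2.1)) := by
    have := (LipschitzWith.prod_fst (α := ℝ) (β := ℝ × ℝ)).prodMk
      (LipschitzWith.prod_fst.comp (LipschitzWith.prod_snd (α := ℝ) (β := ℝ × ℝ)))
    simpa using this
  have h3 := (LipschitzWith.const (α := ℝ × ℝ × ℝ) (1 : ℝ)).prodMk (h1.prodMk (hf.comp h2).neg)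
  have h4 : LipschitzWith (max 1 K) (fun x : ℝ × ℝ × ℝ => ((1 : ℝ), x.2.2, -f (x.1, x.2.1))) := by
    simpa [Function.comp_def] using h3
  exact h4

theorem measurePreserving_shear (h : ℝ) :
    MeasurePreserving (fun z : ℝ × ℝ => (z.1 + h * z.2, z.2)) := by
  have drift' : MeasurePreserving (fun z : ℝ × ℝ => (z.1, z.2 + h * z.1)) := by
    refine (MeasurePreserving.id (volume : Measure ℝ)).skew_product (μc := volume) (μd := volume)
      (g := fun q p => p + h * q) ?_ ?_
    · exact Continuous.measurable (by fun_prop)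
    · exact ae_of_all _ fun q => (measurePreserving_add_right volume _).map_eq
  have hswap : MeasurePreserving (Prod.swap : ℝ × ℝ → ℝ × ℝ) :=
    Measure.measurePreserving_swap (μ := (volume : Measure ℝ)) (ν := (volume : Measure ℝ))
  exact hswap.comp (drift'.comp hswap)

/-- At fixed time the step is a drift in `q` followed by a kick in `p`. Both are shears, hence area
preserving, and time is merely translated. -/
theorem measurePreserving_eulerStep (hf : Continuous f) (h : ℝ) :
    MeasurePreserving (eulerStep f h) := by
  have kick : ∀ t : ℝ, MeasurePreserving (fun z : ℝ × ℝ => (z.1, z.2 - h * f (t, z.1))) := by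
    intro t
    refine (MeasurePreserving.id (volume : Measure ℝ)).skew_product (μc := volume) (μd := volume)
      (g := fun q p => p - h * f (t, q)) ?_ ?_
    · exact Continuous.measurable (by fun_prop)
    · exact ae_of_all _ fun q => (measurePreserving_sub_right volume _).map_eq
  refine (measurePreserving_add_right (volume : Measure ℝ) h).skew_product
    (μc := (volume : Measure (ℝ × ℝ))) (μd := volume)
    (g := fun t z => (z.1 + h * z.2, z.2 - h * f (t, z.1 + h * z.2))) ?_ ?_
  · exact Continuous.measurable (by fun_prop)
  · exact ae_of_all _ fun t => ((kick t).comp (measurePreserving_shear h)).map_eq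

theorem abs_sub_le_of_hasDerivAt {u u' : ℝ → ℝ} {A h : ℝ} (hu : ∀ s, HasDerivAt u (u' s) s)
    (hA : ∀ s, |s| ≤ |h| → |u' s| ≤ A) : |u h - u 0| ≤ A * |h| := by
  have := (convex_uIcc (0 : ℝ) h).norm_image_sub_le_of_norm_hasDerivWithin_le (f := u) (f' := u')
    (C := A) (x := 0) (y := h) (fun s _ => (hu s).hasDerivWithinAt) (fun s hs => by
      refine hA s ?_
      have := abs_sub_left_of_mem_uIcc hs
      simpa using this) left_mem_uIcc right_mem_uIcc
  simpa using this

namespace IsGlobalFlow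

variable (hΨ : IsGlobalFlow (newtonField f) Ψ)
include hΨ

theorem newton_hasDerivAt_time (x : ℝ × ℝ × ℝ) (s : ℝ) :
    HasDerivAt (fun τ => (Ψ τ x).1) 1 s :=
  (ContinuousLinearMap.fst ℝ ℝ (ℝ × ℝ)).hasFDerivAt.comp_hasDerivAt s (hΨ.hasDerivAt x s)

theorem newton_hasDerivAt_pos (x : ℝ × ℝ × ℝ) (s : ℝ) :
    HasDerivAt (fun τ => (Ψ τ x).2.1) (Ψ s x).2.2 s :=
  ((ContinuousLinearMap.fst ℝ ℝ ℝ).comp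
    (ContinuousLinearMap.snd ℝ ℝ (ℝ × ℝ))).hasFDerivAt.comp_hasDerivAt s (hΨ.hasDerivAt x s)

theorem newton_hasDerivAt_momentum (x : ℝ × ℝ × ℝ) (s : ℝ) :
    HasDerivAt (fun τ => (Ψ τ x).2.2) (-f ((Ψ s x).1, (Ψ s x).2.1)) s :=
  ((ContinuousLinearMap.snd ℝ ℝ ℝ).comp
    (ContinuousLinearMap.snd ℝ ℝ (ℝ × ℝ))).hasFDerivAt.comp_hasDerivAt s (hΨ.hasDerivAt x s)

theorem newton_time (x : ℝ × ℝ × ℝ) (s : ℝ) : (Ψ s x).1 = x.1 + s := by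
  have hd : ∀ s, HasDerivAt (fun τ => (Ψ τ x).1 - τ) 0 s := fun s => by
    exact ((hΨ.newton_hasDerivAt_time x s).sub (hasDerivAt_id s)).congr_deriv (sub_self _)
  have := is_const_of_deriv_eq_zero (fun s => (hd s).differentiableAt) (fun s => (hd s).deriv) s 0
  simp only [hΨ.zero, sub_zero] at this
  linarith

theorem newton_momentum_sub_le (hC : ∀ z, |f z| ≤ C) (x : ℝ × ℝ × ℝ) (h : ℝ) :
    |(Ψ h x).2.2 - x.2.2| ≤ C * |h| := by
  simpa [hΨ.zero] using abs_sub_le_of_hasDerivAt (hΨ.newton_hasDerivAt_momentum x)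
    (A := C) (h := h) (fun s _ => by rw [abs_neg]; exact hC _)

theorem newton_pos_sub_le (hC : ∀ z, |f z| ≤ C) (x : ℝ × ℝ × ℝ) (h : ℝ) :
    |(Ψ h x).2.1 - (x.2.1 + h * x.2.2)| ≤ C * h ^ 2 := by
  have hC0 : 0 ≤ C := (abs_nonneg _).trans (hC 0)
  have hd : ∀ s, HasDerivAt (fun τ => (Ψ τ x).2.1 - τ * x.2.2) ((Ψ s x).2.2 - x.2.2) s := fun s => by
    exact ((hΨ.newton_hasDerivAt_pos x s).sub
      ((hasDerivAt_id s).mul_const x.2.2)).congr_deriv (by simp)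
  have := abs_sub_le_of_hasDerivAt hd (A := C * |h|) (h := h) (fun s hs =>
    (hΨ.newton_momentum_sub_le hC x s).trans (mul_le_mul_of_nonneg_left hs hC0))
  simp only [hΨ.zero, zero_mul, sub_zero] at this
  rw [mul_assoc, abs_mul_abs_self, ← sq] at this
  convert this using 2
  ring

/-- The scheme is consistent: its one-step error is `O(h²)`, locally uniformly, using only the bound
and the Lipschitz constant of `f`. -/
theorem newton_dist_eulerStep_le (hK : LipschitzWith K f) (hC : ∀ z, |f z| ≤ C)
    (x : ℝ × ℝ × ℝ) {h : ℝ} (hh : |h| ≤ 1) :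
    dist (Ψ h x) (eulerStep f h x) ≤ (C + K * (2 + C)) * (1 + |x.2.2|) * h ^ 2 := by
  have hC0 : 0 ≤ C := (abs_nonneg _).trans (hC 0)
  have hK0 : (0 : ℝ) ≤ K := K.2
  have hp := abs_nonneg x.2.2
  have hh2 := sq_nonneg h
  have hnn : 0 ≤ (C + K * (2 + C)) * (1 + |x.2.2|) * h ^ 2 := by positivity
  have hmom : |(Ψ h x).2.2 - (x.2.2 - h * f (x.1, x.2.1 + h * x.2.2))|
      ≤ K * (1 + C + 2 * |x.2.2|) * h ^ 2 := by
    have hd : ∀ s, HasDerivAt (fun τ => (Ψ τ x).2.2 + τ * f (x.1, x.2.1 + h * x.2.2))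
        (-f ((Ψ s x).1, (Ψ s x).2.1) + f (x.1, x.2.1 + h * x.2.2)) s := fun s => by
      exact ((hΨ.newton_hasDerivAt_momentum x s).add
        ((hasDerivAt_id s).mul_const (f (x.1, x.2.1 + h * x.2.2)))).congr_deriv (by simp)
    have := abs_sub_le_of_hasDerivAt hd (A := K * ((1 + C + 2 * |x.2.2|) * |h|)) (h := h) ?_
    · simp only [hΨ.zero, zero_mul, add_zero] at this
      rw [mul_assoc, mul_assoc, abs_mul_abs_self, ← sq, ← mul_assoc] at this
      convert this using 2
      ring
    · intro s hs
      have h1 := hK.dist_le_mul (x.1, x.2.1 + h * x.2.2) ((Ψ s x).1, (Ψ s x).2.1)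
      rw [Real.dist_eq] at h1
      rw [neg_add_eq_sub]
      refine h1.trans (mul_le_mul_of_nonneg_left ?_ hK0)
      rw [Prod.dist_eq, Real.dist_eq, Real.dist_eq]
      have h0 := abs_nonneg h
      have hCh : 0 ≤ C * |h| := by positivity
      have hph : 0 ≤ |x.2.2| * |h| := by positivity
      refine max_le ?_ ?_
      · rw [hΨ.newton_time]
        simp only [sub_add_cancel_left, abs_neg]
        nlinarith
      · have h2 := hΨ.newton_pos_sub_le hC x s
        have h3 : s ^ 2 ≤ |h| := by
          rw [← sq_abs]
          nlinarith [abs_nonneg s]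
        have h4 : |x.2.1 + h * x.2.2 - (Ψ s x).2.1| ≤
            |(Ψ s x).2.1 - (x.2.1 + s * x.2.2)| + |(h - s) * x.2.2| := by
          rw [abs_sub_comm (Ψ s x).2.1]
          refine le_trans (le_of_eq ?_) (abs_add_le _ _)
          congr 1; ring
        rw [abs_mul] at h4
        have h5 : |h - s| ≤ 2 * |h| := by
          have := abs_sub h s
          linarith
        nlinarith [mul_le_mul_of_nonneg_right h5 hp, mul_le_mul_of_nonneg_left h3 hC0]
  simp only [eulerStep, Prod.dist_eq, Real.dist_eq]
  refine max_le ?_ (max_le ?_ ?_)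
  · rw [hΨ.newton_time]; simpa using hnn
  · refine (hΨ.newton_pos_sub_le hC x h).trans ?_
    gcongr
    nlinarith [mul_nonneg hC0 hp, mul_nonneg hK0 hp, mul_nonneg (mul_nonneg hK0 hp) hC0,
      mul_nonneg hK0 hC0]
  · refine hmom.trans (mul_le_mul_of_nonneg_right ?_ hh2)
    nlinarith [mul_nonneg hC0 hp, mul_nonneg hK0 hp, mul_nonneg (mul_nonneg hK0 hp) hC0]

/-- For `|h| ≤ 1` preimages of a ball stay in a ball independent of `h`, so the integrals for the
flow and the scheme can be compared on a common compact set. -/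
theorem norm_le_of_newton (hC : ∀ z, |f z| ≤ C) {x : ℝ × ℝ × ℝ} {h r : ℝ} (hh : |h| ≤ 1)
    (hx : ‖Ψ h x‖ ≤ r) : ‖x‖ ≤ 2 * r + 2 * C + 1 := by
  have hC0 : 0 ≤ C := (abs_nonneg _).trans (hC 0)
  have hm := abs_le.1 (hΨ.newton_momentum_sub_le hC x h)
  have hq := abs_le.1 (hΨ.newton_pos_sub_le hC x h)
  rw [Prod.norm_def, Prod.norm_def, max_le_iff, max_le_iff, hΨ.newton_time] at hx
  simp only [Real.norm_eq_abs] at hx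
  obtain ⟨h1, h2, h3⟩ := hx
  have hCh : C * |h| ≤ C := mul_le_of_le_one_right hC0 hh
  have hCh2 : C * h ^ 2 ≤ C := mul_le_of_le_one_right hC0 ((sq_le_one_iff_abs_le_one h).2 hh)
  have hp : |x.2.2| ≤ r + C := by
    rw [abs_le] at h3 ⊢
    constructor <;> linarith
  have hhp : |h * x.2.2| ≤ r + C := by
    rw [abs_mul]
    exact (mul_le_of_le_one_left (abs_nonneg _) hh).trans hp
  rw [Prod.norm_def, Prod.norm_def]
  simp only [Real.norm_eq_abs]
  rw [abs_le] at h1 h2 hh hhp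
  refine max_le (abs_le.2 ⟨?_, ?_⟩) (max_le (abs_le.2 ⟨?_, ?_⟩) (by linarith)) <;> linarith

omit hΨ in
theorem norm_le_of_eulerStep (hC : ∀ z, |f z| ≤ C) {x : ℝ × ℝ × ℝ} {h r : ℝ} (hh : |h| ≤ 1)
    (hx : ‖eulerStep f h x‖ ≤ r) : ‖x‖ ≤ 2 * r + 2 * C + 1 := by
  have hC0 : 0 ≤ C := (abs_nonneg _).trans (hC 0)
  rw [Prod.norm_def, Prod.norm_def, max_le_iff, max_le_iff] at hx
  simp only [Real.norm_eq_abs, eulerStep] at hx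
  obtain ⟨h1, h2, h3⟩ := hx
  have hCh : |h * f (x.1, x.2.1 + h * x.2.2)| ≤ C := by
    rw [abs_mul]
    exact (mul_le_of_le_one_left (abs_nonneg _) hh).trans (hC _)
  have hp : |x.2.2| ≤ r + C := by
    rw [abs_le] at h3 hCh ⊢
    constructor <;> linarith
  have hhp : |h * x.2.2| ≤ r + C := by
    rw [abs_mul]
    exact (mul_le_of_le_one_left (abs_nonneg _) hh).trans hp
  rw [Prod.norm_def, Prod.norm_def]
  simp only [Real.norm_eq_abs]
  rw [abs_le] at h1 h2 hh hhp
  refine max_le (abs_le.2 ⟨?_, ?_⟩) (max_le (abs_le.2 ⟨?_, ?_⟩) (by linarith)) <;> linarith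

/-- The Euler step preserves `∫ g` exactly and differs from the flow by `O(h²)`, so the flow changes
`∫ g` by at most `O(h²)`. -/
theorem newton_integral_comp_sub_le (hK : LipschitzWith K f) (hC : ∀ z, |f z| ≤ C)
    {g : ℝ × ℝ × ℝ → ℝ} {L : ℝ≥0} (hg : LipschitzWith L g) (hgs : HasCompactSupport g) :
    ∃ A : ℝ, ∀ h : ℝ, |h| ≤ 1 → |(∫ x, g (Ψ h x)) - ∫ x, g x| ≤ A * h ^ 2 := by
  have hC0 : 0 ≤ C := (abs_nonneg _).trans (hC 0)
  have hK0 : (0 : ℝ) ≤ K := K.2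
  obtain ⟨r, hr⟩ : ∃ r, ∀ x, r < ‖x‖ → g x = 0 := by
    obtain ⟨r, hr⟩ := hgs.isCompact.isBounded.subset_closedBall 0
    refine ⟨r, fun x hx => image_eq_zero_of_notMem_tsupport fun hx' => ?_⟩
    have := hr hx'
    rw [mem_closedBall_zero_iff] at this
    linarith
  set R := 2 * r + 2 * C + 1
  have hX := lipschitzWith_newtonField hK
  have hzero1 : ∀ h : ℝ, |h| ≤ 1 → ∀ x ∉ Metric.closedBall (0 : ℝ × ℝ × ℝ) R, g (Ψ h x) = 0 := by
    intro h hh x hx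
    refine hr _ (not_le.1 fun hle => hx ?_)
    exact mem_closedBall_zero_iff.2 (hΨ.norm_le_of_newton hC hh hle)
  have hzero2 : ∀ h : ℝ, |h| ≤ 1 → ∀ x ∉ Metric.closedBall (0 : ℝ × ℝ × ℝ) R,
      g (eulerStep f h x) = 0 := by
    intro h hh x hx
    refine hr _ (not_le.1 fun hle => hx ?_)
    exact mem_closedBall_zero_iff.2 (norm_le_of_eulerStep hC hh hle)
  have hB : IsCompact (Metric.closedBall (0 : ℝ × ℝ × ℝ) R) := isCompact_closedBall _ _
  refine ⟨L * ((C + K * (2 + C)) * (1 + R)) * volume.real (Metric.closedBall (0 : ℝ × ℝ × ℝ) R),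
    fun h hh => ?_⟩
  have hcE : Continuous (eulerStep f h) := by
    have := hK.continuous
    unfold eulerStep; fun_prop
  have hc1 : Continuous (fun x => g (Ψ h x)) := hg.continuous.comp (hΨ.lipschitzWith hX h).continuous
  have hc2 : Continuous (fun x => g (eulerStep f h x)) := hg.continuous.comp hcE
  have hi1 : Integrable (fun x => g (Ψ h x)) :=
    hc1.integrable_of_hasCompactSupport (HasCompactSupport.intro hB (hzero1 h hh))
  have hi2 : Integrable (fun x => g (eulerStep f h x)) :=
    hc2.integrable_of_hasCompactSupport (HasCompactSupport.intro hB (hzero2 h hh))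
  have hE : ∫ x, g x = ∫ x, g (eulerStep f h x) := by
    have hmp := measurePreserving_eulerStep hK.continuous h
    have := integral_map (μ := volume) hmp.aemeasurable (f := g)
      hg.continuous.aestronglyMeasurable
    rw [hmp.map_eq] at this
    exact this
  rw [hE, ← integral_sub hi1 hi2]
  rw [← setIntegral_eq_integral_of_forall_compl_eq_zero
    (s := Metric.closedBall (0 : ℝ × ℝ × ℝ) R) (fun x hx => by
      rw [hzero1 h hh x hx, hzero2 h hh x hx, sub_zero])]
  have := norm_setIntegral_le_of_norm_le_const (μ := volume)
    (s := Metric.closedBall (0 : ℝ × ℝ × ℝ) R)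
    (f := fun x => g (Ψ h x) - g (eulerStep f h x))
    (C := L * ((C + K * (2 + C)) * (1 + R) * h ^ 2)) hB.measure_lt_top (fun x hx => ?_)
  · rw [Real.norm_eq_abs] at this
    refine this.trans (le_of_eq ?_)
    ring
  · rw [← dist_eq_norm]
    refine (hg.dist_le_mul _ _).trans (mul_le_mul_of_nonneg_left ?_ L.2)
    refine (hΨ.newton_dist_eulerStep_le hK hC x hh).trans ?_
    have hxR : |x.2.2| ≤ R :=
      ((norm_snd_le x.2).trans (norm_snd_le x)).trans (mem_closedBall_zero_iff.1 hx)
    gcongr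

/-- **Liouville's theorem** for Newton's equation. -/
theorem newton_integral_comp (hK : LipschitzWith K f) (hC : ∀ z, |f z| ≤ C)
    {g : ℝ × ℝ × ℝ → ℝ} {L : ℝ≥0} (hg : LipschitzWith L g) (hgs : HasCompactSupport g) (s : ℝ) :
    ∫ x, g (Ψ s x) = ∫ x, g x := by
  have hX := lipschitzWith_newtonField hK
  have hd : ∀ s, HasDerivAt (fun s => ∫ x, g (Ψ s x)) 0 s := by
    intro s
    have hcs : HasCompactSupport (fun x => g (Ψ s x)) := by
      refine HasCompactSupport.intro
        (hgs.isCompact.image (hΨ.lipschitzWith hX (-s)).continuous) fun x hx => ?_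
      exact image_eq_zero_of_notMem_tsupport fun h => hx ⟨Ψ s x, h, hΨ.neg_apply hX s x⟩
    -- By the group law, the increment at time `s` is the increment at time `0` for `g ∘ Ψ s`, still
    -- Lipschitz with compact support. Increments of order `h²` mean derivative zero.
    obtain ⟨A, hA⟩ := hΨ.newton_integral_comp_sub_le hK hC (hg.comp (hΨ.lipschitzWith hX s)) hcs
    rw [hasDerivAt_iff_isLittleO_nhds_zero]
    have hO : (fun h : ℝ => (∫ x, g (Ψ (s + h) x)) - (∫ x, g (Ψ s x)) - h • (0 : ℝ))
        =O[𝓝 0] fun h : ℝ => h ^ 2 := by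
      refine Asymptotics.IsBigO.of_bound A ?_
      filter_upwards [Metric.ball_mem_nhds (0 : ℝ) one_pos] with h hh
      rw [mem_ball_zero_iff] at hh
      have := hA h hh.le
      simp only [hΨ.add hX, smul_zero, sub_zero, Real.norm_eq_abs, abs_pow, sq_abs]
      exact this
    refine hO.trans_isLittleO ?_
    simpa using Asymptotics.isLittleO_pow_pow (𝕜 := ℝ) (m := 1) (n := 2) (by norm_num)
  have := is_const_of_deriv_eq_zero (fun s => (hd s).differentiableAt) (fun s => (hd s).deriv) s 0
  simpa only [hΨ.zero] using this

end IsGlobalFlow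

end Newton

/-! ### Averaging over all orbits -/

section Newton

variable {f : ℝ × ℝ → ℝ} {K : ℝ≥0} {C : ℝ} {Ψ : ℝ → ℝ × ℝ × ℝ → ℝ × ℝ × ℝ}

/-- Integrate `b(t) g(Ψ s x)` over `(s, x)` in both orders, `b` being a bump in time. Over `s`
first, the orbit integrals give a nonnegative result; over `x` first, Liouville's theorem gives `(∫
b) (∫ g)`. The factor `b` is needed because the full integral over `s` and `x` would count each
orbit infinitely often. -/
theorem IsGlobalFlow.newton_integral_nonneg (hΨ : IsGlobalFlow (newtonField f) Ψ)
    (hK : LipschitzWith K f) (hC : ∀ z, |f z| ≤ C) {g : ℝ × ℝ × ℝ → ℝ} (hg : ContDiff ℝ 1 g)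
    (hgs : HasCompactSupport g) (h : ∀ x, 0 ≤ ∫ s, g (Ψ s x)) : 0 ≤ ∫ x, g x := by
  have hX := lipschitzWith_newtonField hK
  let b : ContDiffBump (0 : ℝ) := default
  have hbc : ContDiff ℝ 1 b := b.contDiff
  have hb0 : 0 < ∫ s, b s := b.integral_pos
  have hgc := hg.continuous
  have hΨc := hΨ.continuous_uncurry hX
  have hbcc := hbc.continuous
  set G : ℝ × (ℝ × ℝ × ℝ) → ℝ := fun z => b z.2.1 * g (Ψ z.1 z.2) with hG
  have hGc : Continuous G := by
    have := hgc.comp hΨc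
    simp only [Function.comp_def] at this
    fun_prop
  obtain ⟨T, hT⟩ : ∃ T, ∀ x ∈ tsupport g, |x.1| ≤ T := by
    obtain ⟨r, hr⟩ := hgs.isCompact.isBounded.subset_closedBall 0
    exact ⟨r, fun x hx => (norm_fst_le x).trans (mem_closedBall_zero_iff.1 (hr hx))⟩
  have hGs : HasCompactSupport G := by
    have hcp : IsCompact ((fun z : ℝ × (ℝ × ℝ × ℝ) => (z.1, Ψ (-z.1) z.2)) ''
        (Icc (-(T + b.rOut)) (T + b.rOut) ×ˢ tsupport g)) := by
      refine (isCompact_Icc.prod hgs.isCompact).image ?_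
      exact continuous_fst.prodMk (hΨc.comp (continuous_fst.neg.prodMk continuous_snd))
    refine HasCompactSupport.intro hcp fun z hz => ?_
    by_contra hne
    obtain ⟨h1, h2⟩ := mul_ne_zero_iff.1 hne
    have h3 : Ψ z.1 z.2 ∈ tsupport g := subset_tsupport _ h2
    have h4 : |z.2.1| < b.rOut := by
      have : z.2.1 ∈ Function.support b := h1
      rw [b.support_eq] at this
      simpa using this
    have h5 := hT _ h3
    rw [hΨ.newton_time] at h5
    refine hz ⟨(z.1, Ψ z.1 z.2), ⟨?_, h3⟩, ?_⟩
    · rw [abs_lt] at h4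
      rw [abs_le] at h5
      constructor <;> simp only <;> linarith
    · simp [hΨ.neg_apply hX]
  have hGi : Integrable G (volume.prod volume) := hGc.integrable_of_hasCompactSupport hGs
  have hslice : ∀ s : ℝ, ∫ x : ℝ × ℝ × ℝ, G (s, x) = ∫ x : ℝ × ℝ × ℝ, b (x.1 - s) * g x := by
    intro s
    have hcd : ContDiff ℝ 1 (fun x : ℝ × ℝ × ℝ => b (x.1 - s) * g x) :=
      (hbc.comp (contDiff_fst.sub contDiff_const)).mul hg
    have hcs : HasCompactSupport (fun x : ℝ × ℝ × ℝ => b (x.1 - s) * g x) := hgs.mul_left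
    obtain ⟨L, hL⟩ := hcd.lipschitzWith_of_hasCompactSupport hcs one_ne_zero
    -- The flow advances time by `s`, so composing `b(t - s) g` with it gives back the slice of `G`.
    rw [← hΨ.newton_integral_comp hK hC hL hcs s]
    refine integral_congr_ae (ae_of_all _ fun x => ?_)
    simp only [hG, hΨ.newton_time, add_sub_cancel_right]
  have hpos : 0 ≤ ∫ z, G z ∂(volume.prod volume) := by
    rw [integral_prod_symm _ hGi]
    refine integral_nonneg fun x => ?_
    simp only [hG, integral_const_mul]
    exact mul_nonneg b.nonneg (h x)
  rw [integral_prod _ hGi] at hpos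
  simp only [hslice] at hpos
  set H : ℝ × (ℝ × ℝ × ℝ) → ℝ := fun z => b (z.2.1 - z.1) * g z.2 with hH
  have hHi : Integrable H (volume.prod volume) := by
    refine Continuous.integrable_of_hasCompactSupport (by fun_prop) ?_
    refine HasCompactSupport.intro
      ((isCompact_Icc (a := -(T + b.rOut)) (b := T + b.rOut)).prod hgs.isCompact) fun z hz => ?_
    by_contra hne
    obtain ⟨h1, h2⟩ := mul_ne_zero_iff.1 hne
    have h3 : z.2 ∈ tsupport g := subset_tsupport _ h2
    have h4 : |z.2.1 - z.1| < b.rOut := by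
      have : z.2.1 - z.1 ∈ Function.support b := h1
      rw [b.support_eq] at this
      simpa using this
    have h5 := hT _ h3
    refine hz ⟨?_, h3⟩
    rw [abs_lt] at h4
    rw [abs_le] at h5
    constructor <;> linarith
  have hswap : ∫ s : ℝ, ∫ x : ℝ × ℝ × ℝ, b (x.1 - s) * g x = (∫ s, b s) * ∫ x, g x := by
    have h1 := integral_prod _ hHi
    rw [integral_prod_symm _ hHi] at h1
    rw [← h1, ← integral_const_mul]
    refine integral_congr_ae (ae_of_all _ fun x => ?_)
    simp only [hH, integral_mul_const]
    congr 1
    exact integral_sub_left_eq_self (fun s => b s) volume x.1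
  rw [hswap] at hpos
  exact nonneg_of_mul_nonneg_right hpos hb0

end Newton

/-! ### Cutoff functions on extended phase space -/

theorem exists_smooth_cutoff : ∃ (b : ℝ → ℝ) (c : ℝ), ContDiff ℝ ∞ b ∧ (∀ s, 0 ≤ b s) ∧
    (∀ s, b s ≤ 1) ∧ (∀ s, |s| < 1 → b s = 1) ∧ (∀ s, |s| < 1 → deriv b s = 0) ∧
    (∀ s, 2 < |s| → b s = 0) ∧ (∀ s, 2 < |s| → deriv b s = 0) ∧ (∀ s, |deriv b s| ≤ c) := by
  let b : ContDiffBump (0 : ℝ) := ⟨1, 2, one_pos, one_lt_two⟩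
  have hb : ContDiff ℝ ∞ b := b.contDiff
  obtain ⟨c, hc⟩ := (hb.continuous_deriv (by norm_num)).bounded_above_of_compact_support
    (b.hasCompactSupport.deriv)
  refine ⟨b, c, hb, fun _ => b.nonneg, fun _ => b.le_one, fun s hs => ?_, fun s hs => ?_,
    fun s hs => ?_, fun s hs => ?_, hc⟩
  · exact b.one_of_mem_closedBall (by simpa using hs.le)
  · have : (b : ℝ → ℝ) =ᶠ[𝓝 s] fun _ => 1 := by
      filter_upwards [Metric.isOpen_ball.mem_nhds
        (show s ∈ Metric.ball (0 : ℝ) 1 by simpa using hs)] with y hy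
      exact b.one_of_mem_closedBall (Metric.ball_subset_closedBall hy)
    rw [this.deriv_eq, deriv_const]
  · exact b.zero_of_le_dist (by simpa using hs.le)
  · have : (b : ℝ → ℝ) =ᶠ[𝓝 s] fun _ => 0 := by
      filter_upwards [(isOpen_lt continuous_const continuous_abs).mem_nhds hs] with y hy
      exact b.zero_of_le_dist (by simpa using (show (2 : ℝ) < |y| from hy).le)
    rw [this.deriv_eq, deriv_const]

/-- A cutoff function of the momentum, the time and the initial position of the free motion. -/
noncomputable def phaseCutoff (b : ℝ → ℝ) (P L M : ℝ) (x : ℝ × ℝ × ℝ) : ℝ :=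
  b (x.2.2 / P) * b (x.1 / L) * b ((x.2.1 - x.2.2 * x.1) / M)

theorem contDiff_phaseCutoff {b : ℝ → ℝ} (hb : ContDiff ℝ ∞ b) (P L M : ℝ) :
    ContDiff ℝ ∞ (phaseCutoff b P L M) := by
  unfold phaseCutoff; fun_prop

theorem fderiv_phaseCutoff {b : ℝ → ℝ} (hb : ContDiff ℝ ∞ b) (P L M : ℝ) (x v : ℝ × ℝ × ℝ) :
    fderiv ℝ (phaseCutoff b P L M) x v =
      (deriv b (x.2.2 / P) * (v.2.2 / P) * b (x.1 / L) +
        b (x.2.2 / P) * (deriv b (x.1 / L) * (v.1 / L))) * b ((x.2.1 - x.2.2 * x.1) / M) +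
      b (x.2.2 / P) * b (x.1 / L) * (deriv b ((x.2.1 - x.2.2 * x.1) / M) *
        ((v.2.1 - (v.2.2 * x.1 + x.2.2 * v.1)) / M)) := by
  have hd : Differentiable ℝ b := hb.differentiable (by norm_num)
  have hφ : DifferentiableAt ℝ (phaseCutoff b P L M) x :=
    (contDiff_phaseCutoff hb P L M).differentiable (by norm_num) x
  have h1 : HasDerivAt (fun s : ℝ => phaseCutoff b P L M (x + s • v))
      (fderiv ℝ (phaseCutoff b P L M) x v) 0 := hφ.hasFDerivAt.hasLineDerivAt v
  refine h1.unique ?_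
  have lin : ∀ y w : ℝ, HasDerivAt (fun s : ℝ => y + s * w) w 0 := fun y w => by
    simpa using ((hasDerivAt_id (0 : ℝ)).mul_const w).const_add y
  have comp : ∀ {u : ℝ → ℝ} {u' : ℝ} (y : ℝ), HasDerivAt u u' 0 → u 0 = y →
      HasDerivAt (fun s => b (u s)) (deriv b y * u') 0 := by
    rintro u u' _ hu rfl
    exact (hd (u 0)).hasDerivAt.comp (0 : ℝ) hu
  have hp := comp (x.2.2 / P) ((lin x.2.2 v.2.2).div_const P) (by simp)
  have ht := comp (x.1 / L) ((lin x.1 v.1).div_const L) (by simp)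
  have ha := comp ((x.2.1 - x.2.2 * x.1) / M)
    (((lin x.2.1 v.2.1).sub ((lin x.2.2 v.2.2).mul (lin x.1 v.1))).div_const M) (by simp)
  have := (hp.mul ht).mul ha
  exact this.congr_deriv (by simp)

/-- The function `y ↦ y'² - f_q y²` on extended phase space whose integral along an orbit is the
second variation. -/
noncomputable def indexDensity (f : ℝ × ℝ → ℝ) (φ : ℝ × ℝ × ℝ → ℝ) (x : ℝ × ℝ × ℝ) : ℝ :=
  (fderiv ℝ φ x (newtonField f x)) ^ 2 - fderiv ℝ f (x.1, x.2.1) (0, 1) * φ x ^ 2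

section

variable {f : ℝ × ℝ → ℝ}

theorem contDiff_forceDeriv (hf : ContDiff ℝ ∞ f) :
    ContDiff ℝ ∞ (fun x : ℝ × ℝ × ℝ => fderiv ℝ f (x.1, x.2.1) (0, 1)) := by
  have h1 : ContDiff ℝ ∞ (fun z : ℝ × ℝ => fderiv ℝ f z (0, 1)) :=
    (hf.fderiv_right (m := ∞) (by norm_num)).clm_apply contDiff_const
  exact h1.comp (f := fun x : ℝ × ℝ × ℝ => (x.1, x.2.1)) (by fun_prop)

theorem contDiff_indexDensity (hf : ContDiff ℝ ∞ f) {φ : ℝ × ℝ × ℝ → ℝ} (hφ : ContDiff ℝ ∞ φ) :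
    ContDiff ℝ ∞ (indexDensity f φ) :=
  (((hφ.fderiv_right (m := ∞) (by norm_num)).clm_apply (contDiff_newtonField hf)).pow 2).sub
    ((contDiff_forceDeriv hf).mul (hφ.pow 2))

theorem hasCompactSupport_indexDensity {φ : ℝ × ℝ × ℝ → ℝ} (hφ : HasCompactSupport φ) :
    HasCompactSupport (indexDensity f φ) := by
  refine HasCompactSupport.intro hφ.isCompact fun x hx => ?_
  have h1 : φ x = 0 := image_eq_zero_of_notMem_tsupport hx
  have h2 : fderiv ℝ φ x = 0 := by
    by_contra h
    exact hx (support_fderiv_subset ℝ h)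
  simp [indexDensity, h1, h2]

theorem hasCompactSupport_phaseCutoff {b : ℝ → ℝ} (hb2 : ∀ s, 2 < |s| → b s = 0) {P L M : ℝ}
    (hP : 0 < P) (hL : 0 < L) (hM : 0 < M) : HasCompactSupport (phaseCutoff b P L M) := by
  have key : ∀ {u N : ℝ}, 0 < N → b (u / N) ≠ 0 → |u| ≤ 2 * N := by
    intro u N hN h
    by_contra! hlt
    refine h (hb2 _ ?_)
    rwa [abs_div, abs_of_pos hN, lt_div_iff₀ hN]
  refine HasCompactSupport.intro
    (K := Icc (-(2 * L)) (2 * L) ×ˢ (Icc (-(2 * M + 2 * P * (2 * L))) (2 * M + 2 * P * (2 * L)) ×ˢ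
      Icc (-(2 * P)) (2 * P)))
    (isCompact_Icc.prod (isCompact_Icc.prod isCompact_Icc)) fun x hx => ?_
  by_contra hne
  obtain ⟨h12, h3⟩ := mul_ne_zero_iff.1 hne
  obtain ⟨h1, h2⟩ := mul_ne_zero_iff.1 h12
  have k1 := key hP h1
  have k2 := key hL h2
  have k3 := key hM h3
  have k4 : |x.2.2 * x.1| ≤ 2 * P * (2 * L) := by
    rw [abs_mul]
    exact mul_le_mul k1 k2 (abs_nonneg _) (by positivity)
  refine hx ⟨abs_le.1 k2, abs_le.1 ?_, abs_le.1 k1⟩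
  have := abs_add_le (x.2.1 - x.2.2 * x.1) (x.2.2 * x.1)
  rw [sub_add_cancel] at this
  linarith

end

/-! ### Estimate of the averaged second variation of the cutoff -/

section

variable {f : ℝ × ℝ → ℝ}

/-- Integration by parts in `q` moves the derivative from `f` to `φ²`. The term `f_q φ²` does not
become small for wide cutoffs, whereas `f φ φ_q` gains the inverse width of `φ` in `q`. -/
theorem integral_indexDensity_eq (hf : ContDiff ℝ ∞ f) {φ : ℝ × ℝ × ℝ → ℝ} (hφ : ContDiff ℝ ∞ φ)
    (hφs : HasCompactSupport φ) :
    Integrable (fun x : ℝ × ℝ × ℝ => (fderiv ℝ φ x (newtonField f x)) ^ 2 +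
      2 * f (x.1, x.2.1) * φ x * fderiv ℝ φ x (0, 1, 0)) ∧
    ∫ x, indexDensity f φ x = ∫ x : ℝ × ℝ × ℝ, ((fderiv ℝ φ x (newtonField f x)) ^ 2 +
      2 * f (x.1, x.2.1) * φ x * fderiv ℝ φ x (0, 1, 0)) := by
  set F : ℝ × ℝ × ℝ → ℝ := fun x => f (x.1, x.2.1)
  have hFc : ContDiff ℝ ∞ F := hf.comp (f := fun x : ℝ × ℝ × ℝ => (x.1, x.2.1)) (by fun_prop)
  have hF' : ∀ x, fderiv ℝ F x (0, 1, 0) = fderiv ℝ f (x.1, x.2.1) (0, 1) := by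
    intro x
    have h1 : HasFDerivAt f (fderiv ℝ f (x.1, x.2.1)) (x.1, x.2.1) :=
      (hf.differentiable (by norm_num) _).hasFDerivAt
    have h2 : HasFDerivAt (fun x : ℝ × ℝ × ℝ => (x.1, x.2.1))
        ((ContinuousLinearMap.fst ℝ ℝ (ℝ × ℝ)).prod ((ContinuousLinearMap.fst ℝ ℝ ℝ).comp
          (ContinuousLinearMap.snd ℝ ℝ (ℝ × ℝ)))) x :=
      hasFDerivAt_fst.prodMk (hasFDerivAt_fst.comp x hasFDerivAt_snd)
    have h3 : HasFDerivAt F _ x := h1.comp x h2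
    rw [h3.fderiv]
    simp
  have hsq : ∀ x v, fderiv ℝ (fun x => φ x ^ 2) x v = 2 * φ x * fderiv ℝ φ x v := by
    intro x v
    have := ((hφ.differentiable (by norm_num) x).hasFDerivAt.pow 2).fderiv
    simp only [this]
    simp
  have hφ' : ∀ v : ℝ × ℝ × ℝ, Continuous fun x => fderiv ℝ φ x v := fun v =>
    ((hφ.fderiv_right (m := ∞) (by norm_num)).clm_apply contDiff_const).continuous
  have hFv : Continuous fun x => fderiv ℝ F x (0, 1, 0) :=
    ((hFc.fderiv_right (m := ∞) (by norm_num)).clm_apply contDiff_const).continuous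
  have hs2 : HasCompactSupport (fun x => φ x ^ 2) := by
    have : HasCompactSupport (fun x => φ x * φ x) := hφs.mul_left
    simpa only [sq] using this
  have hφc := hφ.continuous
  have hFcc := hFc.continuous
  have i1 : Integrable (fun x => 2 * F x * φ x * fderiv ℝ φ x (0, 1, 0)) := by
    refine Continuous.integrable_of_hasCompactSupport ?_ ?_
    · have := hφ' (0, 1, 0); fun_prop
    · exact (hφs.mul_left (f := fun x => 2 * F x)).mul_right
  have i2 : Integrable (fun x => φ x ^ 2 * fderiv ℝ F x (0, 1, 0)) :=
    Continuous.integrable_of_hasCompactSupport (by fun_prop) hs2.mul_right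
  have hv2 : (volume : Measure (ℝ × ℝ)).IsAddHaarMeasure :=
    inferInstanceAs ((volume : Measure ℝ).prod (volume : Measure ℝ)).IsAddHaarMeasure
  have hv3 : (volume : Measure (ℝ × ℝ × ℝ)).IsAddHaarMeasure :=
    inferInstanceAs ((volume : Measure ℝ).prod (volume : Measure (ℝ × ℝ))).IsAddHaarMeasure
  have ibp := integral_mul_fderiv_eq_neg_fderiv_mul_of_integrable (μ := (volume : Measure (ℝ × ℝ × ℝ)))
    (f := fun x => φ x ^ 2) (g := F) (v := (0, 1, 0)) (by
      refine i1.congr (ae_of_all _ fun x => ?_)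
      simp only [hsq]; ring) i2
      (Continuous.integrable_of_hasCompactSupport (by fun_prop) hs2.mul_right)
      (fun x _ => (hφ.pow 2).differentiable (by norm_num) x)
      (fun x _ => hFc.differentiable (by norm_num) x)
  have i3 : Integrable (fun x => (fderiv ℝ φ x (newtonField f x)) ^ 2) := by
    refine Continuous.integrable_of_hasCompactSupport ?_ ?_
    · exact (((hφ.fderiv_right (m := ∞) (by norm_num)).clm_apply
        (contDiff_newtonField hf)).pow 2).continuous
    · refine HasCompactSupport.intro hφs.isCompact fun x hx => ?_
      have h2 : fderiv ℝ φ x = 0 := by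
        by_contra h
        exact hx (support_fderiv_subset ℝ h)
      simp [h2]
  have e1 : ∫ x, indexDensity f φ x =
      (∫ x, (fderiv ℝ φ x (newtonField f x)) ^ 2) - ∫ x, φ x ^ 2 * fderiv ℝ F x (0, 1, 0) := by
    rw [← integral_sub i3 i2]
    refine integral_congr_ae (ae_of_all _ fun x => ?_)
    simp only [indexDensity, hF']; ring
  refine ⟨i3.add i1, ?_⟩
  rw [e1, ibp, integral_add i3 i1, sub_neg_eq_add]
  congr 1
  refine integral_congr_ae (ae_of_all _ fun x => ?_)
  simp only [hsq]; ring

theorem integrable_and_integral_weight (R P : ℝ) (hR : 0 ≤ R) (hP : 0 ≤ P) :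
    Integrable (fun x : ℝ × ℝ × ℝ => (1 + x.1 ^ 2)⁻¹ *
      ((Icc (-R) R).indicator 1 x.2.1 * (Icc (-(2 * P)) (2 * P)).indicator 1 x.2.2)) ∧
    ∫ x : ℝ × ℝ × ℝ, (1 + x.1 ^ 2)⁻¹ *
      ((Icc (-R) R).indicator 1 x.2.1 * (Icc (-(2 * P)) (2 * P)).indicator 1 x.2.2) =
      8 * Real.pi * R * P := by
  have hi : ∀ r : ℝ, Integrable ((Icc (-r) r).indicator (1 : ℝ → ℝ)) := fun r =>
    (integrable_indicator_iff measurableSet_Icc).2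
      (integrableOn_const (μ := volume) (by simp) (by simp))
  have hv : ∀ r : ℝ, 0 ≤ r → ∫ s, (Icc (-r) r).indicator (1 : ℝ → ℝ) s = 2 * r := by
    intro r hr
    rw [integral_indicator_one measurableSet_Icc, Real.volume_real_Icc]
    rw [max_eq_left (by linarith)]; ring
  constructor
  · exact integrable_inv_one_add_sq.mul_prod ((hi R).mul_prod (hi (2 * P)))
  · have h1 := integral_prod_mul (μ := (volume : Measure ℝ)) (ν := (volume : Measure (ℝ × ℝ)))
      (fun t : ℝ => (1 + t ^ 2)⁻¹) (fun y : ℝ × ℝ =>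
        (Icc (-R) R).indicator (1 : ℝ → ℝ) y.1 * (Icc (-(2 * P)) (2 * P)).indicator (1 : ℝ → ℝ) y.2)
    have h2 := integral_prod_mul (μ := (volume : Measure ℝ)) (ν := (volume : Measure ℝ))
      ((Icc (-R) R).indicator (1 : ℝ → ℝ)) ((Icc (-(2 * P)) (2 * P)).indicator (1 : ℝ → ℝ))
    rw [hv R hR, hv (2 * P) (by linarith)] at h2
    have h3 := integral_univ_inv_one_add_sq
    refine h1.trans ?_
    rw [h3]
    refine (congrArg (Real.pi * ·) h2).trans ?_
    ring

/-- The support of the momentum, time and position cutoff. -/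
def slantedBox (P L M : ℝ) : Set (ℝ × ℝ × ℝ) :=
  {x | |x.1| ≤ 2 * L ∧ |x.2.1 - x.2.2 * x.1| ≤ 2 * M ∧ |x.2.2| ≤ 2 * P}

theorem measurableSet_slantedBox (P L M : ℝ) : MeasurableSet (slantedBox P L M) := by
  refine IsClosed.measurableSet ?_
  have h1 : Continuous fun x : ℝ × ℝ × ℝ => |x.1| := by fun_prop
  have h2 : Continuous fun x : ℝ × ℝ × ℝ => |x.2.1 - x.2.2 * x.1| := by fun_prop
  have h3 : Continuous fun x : ℝ × ℝ × ℝ => |x.2.2| := by fun_prop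
  exact (isClosed_le h1 continuous_const).inter
    ((isClosed_le h2 continuous_const).inter (isClosed_le h3 continuous_const))

/-- The shear `q ↦ q - p t` preserves volume and straightens the set to a box with sides `4L`, `4M`,
`4P`. -/
theorem volume_slantedBox {P L M : ℝ} (hL : 0 ≤ L) (hM : 0 ≤ M) :
    volume (slantedBox P L M) = ENNReal.ofReal (64 * L * M * P) := by
  have hmp : MeasurePreserving (fun x : ℝ × (ℝ × ℝ) => (x.1, (x.2.1 + -x.1 * x.2.2, x.2.2))) := by
    refine (MeasurePreserving.id (volume : Measure ℝ)).skew_product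
      (μc := (volume : Measure (ℝ × ℝ))) (μd := volume)
      (g := fun t z => (z.1 + -t * z.2, z.2)) ?_ ?_
    · exact Continuous.measurable (by fun_prop)
    · exact ae_of_all _ fun t => (measurePreserving_shear (-t)).map_eq
  have hpre : slantedBox P L M = (fun x : ℝ × (ℝ × ℝ) => (x.1, (x.2.1 + -x.1 * x.2.2, x.2.2))) ⁻¹'
      (Icc (-(2 * L)) (2 * L) ×ˢ (Icc (-(2 * M)) (2 * M) ×ˢ Icc (-(2 * P)) (2 * P))) := by
    ext x
    have : x.2.1 + -x.1 * x.2.2 = x.2.1 - x.2.2 * x.1 := by ring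
    simp only [slantedBox, mem_ofPred_eq, mem_preimage, mem_prod, mem_Icc, abs_le, this]
  rw [hpre, hmp.measure_preimage (measurableSet_Icc.prod
    (measurableSet_Icc.prod measurableSet_Icc)).nullMeasurableSet]
  rw [Measure.volume_eq_prod, Measure.prod_prod, Measure.volume_eq_prod, Measure.prod_prod]
  simp only [Real.volume_Icc]
  rw [← ENNReal.ofReal_mul (by linarith), ← ENNReal.ofReal_mul (by linarith)]
  congr 1; ring

set_option maxHeartbeats 2000000 in
-- Since `q - p t` is constant along free motion, its derivative along the Newton field is only `f
-- t`, and `p` changes only by `-f`. Apart from the time cutoff, every term thus carries a factor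
-- `f`, which confines it to `|q| ≤ R` with an integrable weight in `t`; the decay of `f` also
-- absorbs the factor `t²` in `(f t)²`.
theorem phaseCutoff_density_le {b : ℝ → ℝ} {c C R : ℝ} (hb : ContDiff ℝ ∞ b) (hb0 : ∀ s, 0 ≤ b s)
    (hb1 : ∀ s, b s ≤ 1) (hb2 : ∀ s, 2 < |s| → b s = 0) (hb2' : ∀ s, 2 < |s| → deriv b s = 0)
    (hbc : ∀ s, |deriv b s| ≤ c) (hC : ∀ z : ℝ × ℝ, |f z| ≤ C * (1 + z.1 ^ 2)⁻¹)
    (hR : ∀ z : ℝ × ℝ, R < |z.2| → f z = 0) {P L M : ℝ} (hP : 0 < P) (hL : 0 < L) (hM : 0 < M)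
    (x : ℝ × ℝ × ℝ) :
    (fderiv ℝ (phaseCutoff b P L M) x (newtonField f x)) ^ 2 +
      2 * f (x.1, x.2.1) * phaseCutoff b P L M x * fderiv ℝ (phaseCutoff b P L M) x (0, 1, 0) ≤
    (slantedBox P L M).indicator (fun _ => 3 * (c / L) ^ 2) x +
      (3 * (c * C / P) ^ 2 + 3 * (c * C / M) ^ 2 + 2 * (c * C / M)) *
      ((1 + x.1 ^ 2)⁻¹ *
      ((Icc (-R) R).indicator 1 x.2.1 * (Icc (-(2 * P)) (2 * P)).indicator 1 x.2.2)) := by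
  obtain ⟨t, q, p⟩ := x
  have hc0 : 0 ≤ c := (abs_nonneg _).trans (hbc 0)
  have hC0 : 0 ≤ C := by
    have := (abs_nonneg _).trans (hC 0)
    simpa using this
  rw [fderiv_phaseCutoff hb, fderiv_phaseCutoff hb]
  simp only [newtonField, phaseCutoff]
  have far : ∀ {u N : ℝ}, 0 < N → 2 * N < |u| → 2 < |u / N| := by
    intro u N hN h
    rwa [abs_div, abs_of_pos hN, lt_div_iff₀ hN]
  set A := b (p / P) with hA
  set A' := deriv b (p / P) with hA'
  set B := b (t / L) with hB
  set B' := deriv b (t / L) with hB'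
  set D := b ((q - p * t) / M) with hD
  set D' := deriv b ((q - p * t) / M) with hD'
  have hD'c : |D'| ≤ c := hbc _
  have hB'c : |B'| ≤ c := hbc _
  have hA'c : |A'| ≤ c := hbc _
  have hA01 : |A| ≤ 1 := by rw [abs_of_nonneg (hb0 _)]; exact hb1 _
  have hB01 : |B| ≤ 1 := by rw [abs_of_nonneg (hb0 _)]; exact hb1 _
  have hD01 : |D| ≤ 1 := by rw [abs_of_nonneg (hb0 _)]; exact hb1 _
  set w : ℝ := (1 + t ^ 2)⁻¹ * ((Icc (-R) R).indicator (1 : ℝ → ℝ) q *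
    (Icc (-(2 * P)) (2 * P)).indicator (1 : ℝ → ℝ) p) with hw
  have ht1 : (1 + t ^ 2)⁻¹ ≤ 1 := inv_le_one_of_one_le₀ (by nlinarith [sq_nonneg t])
  have ht0 : 0 < (1 + t ^ 2)⁻¹ := by positivity
  have hw0 : 0 ≤ w := by
    refine mul_nonneg ht0.le (mul_nonneg ?_ ?_) <;>
      exact indicator_nonneg (fun _ _ => zero_le_one) _
  -- The derivative of the cutoff along the Newton field splits into contributions of the time,
  -- momentum and position factors, in this order.
  set T1 := A * (B' * (1 / L)) * D with hT1
  set T2 := A' * (-f (t, q) / P) * B * D with hT2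
  set T3 := A * B * (D' * (f (t, q) * t / M)) with hT3
  have b1 : T1 ^ 2 ≤ (slantedBox P L M).indicator (fun _ => (c / L) ^ 2) (t, q, p) := by
    by_cases hx : (t, q, p) ∈ slantedBox P L M
    · rw [indicator_of_mem hx, ← sq_abs]
      gcongr
      rw [hT1, abs_mul, abs_mul, abs_mul, abs_of_pos (by positivity : 0 < 1 / L)]
      calc |A| * (|B'| * (1 / L)) * |D| ≤ 1 * (c * (1 / L)) * 1 := by gcongr
        _ = c / L := by ring
    · rw [indicator_of_notMem hx]
      have : T1 = 0 := by
        simp only [slantedBox, mem_ofPred_eq, not_and_or, not_le] at hx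
        rcases hx with h | h | h
        · simp [hT1, hB', hb2' _ (far hL h)]
        · simp [hT1, hD, hb2 _ (far hM h)]
        · simp [hT1, hA, hb2 _ (far hP h)]
      simp [this]
  have bound : (T2 ^ 2 ≤ (c * C / P) ^ 2 * w ∧ T3 ^ 2 ≤ (c * C / M) ^ 2 * w) ∧
      2 * f (t, q) * (A * B * D) * (A * B * (D' / M)) ≤ 2 * (c * C / M) * w := by
    by_cases hq : R < |q|
    · have h0 : f (t, q) = 0 := hR (t, q) hq
      simp only [hT2, hT3, h0]
      refine ⟨⟨?_, ?_⟩, ?_⟩ <;> simp only [neg_zero, zero_div, mul_zero, zero_mul, ne_eq,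
        OfNat.ofNat_ne_zero, not_false_eq_true, zero_pow] <;> positivity
    by_cases hp : 2 * P < |p|
    · have h1 : A = 0 := hb2 _ (far hP hp)
      have h2 : A' = 0 := hb2' _ (far hP hp)
      simp only [hT2, hT3, h1, h2]
      refine ⟨⟨?_, ?_⟩, ?_⟩ <;> simp only [mul_zero, zero_mul, ne_eq,
        OfNat.ofNat_ne_zero, not_false_eq_true, zero_pow] <;> positivity
    have hwt : w = (1 + t ^ 2)⁻¹ := by
      rw [hw, indicator_of_mem (show q ∈ Icc (-R) R from abs_le.1 (not_lt.1 hq)),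
        indicator_of_mem (show p ∈ Icc (-(2 * P)) (2 * P) from abs_le.1 (not_lt.1 hp))]
      simp
    rw [hwt]
    have hf1 : |f (t, q)| ≤ C * (1 + t ^ 2)⁻¹ := hC (t, q)
    have hf2 : f (t, q) ^ 2 ≤ C ^ 2 * (1 + t ^ 2)⁻¹ := by
      rw [← sq_abs]
      calc |f (t, q)| ^ 2 ≤ (C * (1 + t ^ 2)⁻¹) ^ 2 := by gcongr
        _ = C ^ 2 * ((1 + t ^ 2)⁻¹ * (1 + t ^ 2)⁻¹) := by ring
        _ ≤ C ^ 2 * ((1 + t ^ 2)⁻¹ * 1) := by gcongr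
        _ = _ := by ring
    have hf3 : (f (t, q) * t) ^ 2 ≤ C ^ 2 * (1 + t ^ 2)⁻¹ := by
      rw [mul_pow, ← sq_abs]
      calc |f (t, q)| ^ 2 * t ^ 2 ≤ (C * (1 + t ^ 2)⁻¹) ^ 2 * (1 + t ^ 2) := by
            gcongr; linarith
        _ = C ^ 2 * (1 + t ^ 2)⁻¹ * ((1 + t ^ 2)⁻¹ * (1 + t ^ 2)) := by ring
        _ = _ := by rw [inv_mul_cancel₀ (by positivity), mul_one]
    have sq1 : ∀ {u v : ℝ}, |u| ≤ v → u ^ 2 ≤ v ^ 2 := fun {u v} h => by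
      rw [← sq_abs]; gcongr
    refine ⟨⟨?_, ?_⟩, ?_⟩
    · calc T2 ^ 2 = (A' ^ 2 * B ^ 2 * D ^ 2) * (f (t, q) ^ 2 / P ^ 2) := by rw [hT2]; ring
        _ ≤ (c ^ 2 * 1 ^ 2 * 1 ^ 2) * (C ^ 2 * (1 + t ^ 2)⁻¹ / P ^ 2) := by
            have := sq1 hA'c; have := sq1 hB01; have := sq1 hD01
            gcongr
        _ = _ := by ring
    · calc T3 ^ 2 = (A ^ 2 * B ^ 2 * D' ^ 2) * ((f (t, q) * t) ^ 2 / M ^ 2) := by rw [hT3]; ring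
        _ ≤ (1 ^ 2 * 1 ^ 2 * c ^ 2) * (C ^ 2 * (1 + t ^ 2)⁻¹ / M ^ 2) := by
            have := sq1 hA01; have := sq1 hB01; have := sq1 hD'c
            gcongr
        _ = _ := by ring
    · refine (le_abs_self _).trans ?_
      simp only [abs_mul, abs_div, abs_of_pos hM, abs_two]
      calc 2 * |f (t, q)| * (|A| * |B| * |D|) * (|A| * |B| * (|D'| / M))
          ≤ 2 * (C * (1 + t ^ 2)⁻¹) * (1 * 1 * 1) * (1 * 1 * (c / M)) := by gcongr
        _ = _ := by ring
  obtain ⟨⟨b2, b3⟩, b4⟩ := bound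
  have ind3 : (slantedBox P L M).indicator (fun _ => 3 * (c / L) ^ 2) (t, q, p) =
      3 * (slantedBox P L M).indicator (fun _ => (c / L) ^ 2) (t, q, p) := by
    by_cases hx : (t, q, p) ∈ slantedBox P L M <;> simp [hx]
  have e1 : (A' * (-f (t, q) / P) * B + A * (B' * (1 / L))) * D +
      A * B * (D' * ((p - (-f (t, q) * t + p * 1)) / M)) = T1 + T2 + T3 := by
    rw [hT1, hT2, hT3]; ring
  have e2 : 2 * f (t, q) * (A * B * D) * ((A' * (0 / P) * B + A * (B' * (0 / L))) * D +
      A * B * (D' * ((1 - (0 * t + p * 0)) / M))) =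
      2 * f (t, q) * (A * B * D) * (A * B * (D' / M)) := by ring
  rw [e1, e2, ind3]
  -- This is `(T1 + T2 + T3)² ≤ 3 (T1² + T2² + T3²)`.
  nlinarith [sq_nonneg (T1 - T2), sq_nonneg (T1 - T3), sq_nonneg (T2 - T3)]

/-- The contributions are of orders `L M P / L²` (time cutoff), `P / P²`, `P / M²` and `P / M`
(force terms). The choice `L = P⁴`, `M = P²` makes each `O(1/P)`. -/
theorem exists_integral_phaseCutoff_le {b : ℝ → ℝ} {c C R : ℝ} (hf : ContDiff ℝ ∞ f)
    (hb : ContDiff ℝ ∞ b) (hb0 : ∀ s, 0 ≤ b s)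
    (hb1 : ∀ s, b s ≤ 1) (hb2 : ∀ s, 2 < |s| → b s = 0) (hb2' : ∀ s, 2 < |s| → deriv b s = 0)
    (hbc : ∀ s, |deriv b s| ≤ c) (hC : ∀ z : ℝ × ℝ, |f z| ≤ C * (1 + z.1 ^ 2)⁻¹) (hR0 : 0 ≤ R)
    (hR : ∀ z : ℝ × ℝ, R < |z.2| → f z = 0) :
    ∃ A : ℝ, ∀ P : ℝ, 1 ≤ P →
      ∫ x, indexDensity f (phaseCutoff b P (P ^ 4) (P ^ 2)) x ≤ A / P := by
  have hc0 : 0 ≤ c := (abs_nonneg _).trans (hbc 0)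
  have hC0 : 0 ≤ C := by
    have := (abs_nonneg _).trans (hC 0)
    simpa using this
  refine ⟨192 * c ^ 2 + 8 * Real.pi * R * (6 * (c * C) ^ 2 + 2 * (c * C)), fun P hP1 => ?_⟩
  have hP : 0 < P := by linarith
  have hL : 0 < P ^ 4 := by positivity
  have hM : 0 < P ^ 2 := by positivity
  obtain ⟨wi, wv⟩ := integrable_and_integral_weight R P hR0 hP.le
  have hvol := volume_slantedBox (P := P) hL.le hM.le
  have hsi : Integrable ((slantedBox P (P ^ 4) (P ^ 2)).indicator
      (fun _ => 3 * (c / P ^ 4) ^ 2)) :=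
    (integrable_indicator_iff (measurableSet_slantedBox _ _ _)).2
      (integrableOn_const (μ := volume) (by rw [hvol]; exact ENNReal.ofReal_ne_top)
        enorm_ne_top)
  have hφ := contDiff_phaseCutoff hb P (P ^ 4) (P ^ 2)
  have hφs := hasCompactSupport_phaseCutoff hb2 hP hL hM
  obtain ⟨di, dv⟩ := integral_indexDensity_eq hf hφ hφs
  rw [dv]
  refine (integral_mono di (hsi.add (wi.const_mul
    (3 * (c * C / P) ^ 2 + 3 * (c * C / P ^ 2) ^ 2 + 2 * (c * C / P ^ 2))))
    (fun x => phaseCutoff_density_le hb hb0 hb1 hb2 hb2' hbc hC hR hP hL hM x)).trans ?_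
  simp only [Pi.add_apply]
  rw [integral_add hsi (wi.const_mul _), integral_const_mul, wv,
    integral_indicator_const _ (measurableSet_slantedBox _ _ _), Measure.real, hvol,
    ENNReal.toReal_ofReal (by positivity), smul_eq_mul]
  have hinv : P⁻¹ ≤ 1 := inv_le_one_of_one_le₀ hP1
  have e1 : 64 * P ^ 4 * P ^ 2 * P * (3 * (c / P ^ 4) ^ 2) = 192 * c ^ 2 * P⁻¹ := by
    field_simp; ring
  have e2 : (3 * (c * C / P) ^ 2 + 3 * (c * C / P ^ 2) ^ 2 + 2 * (c * C / P ^ 2)) *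
      (8 * Real.pi * R * P) = 8 * Real.pi * R *
      (3 * (c * C) ^ 2 + 3 * (c * C) ^ 2 * P⁻¹ ^ 2 + 2 * (c * C)) * P⁻¹ := by
    field_simp
  have e3 : P⁻¹ ^ 2 ≤ 1 := pow_le_one₀ (by positivity) hinv
  rw [e1, e2, div_eq_mul_inv, ← add_mul]
  have hpi := Real.pi_pos
  gcongr
  nlinarith [sq_nonneg (c * C)]

end

/-! ### Negative averaged second variation and an unstable orbit -/

section

variable {f : ℝ × ℝ → ℝ}

/-- Otherwise `f` would be constant in `q`, hence zero because it vanishes for large `|q|`. -/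
theorem exists_forceDeriv_ne_zero {R : ℝ} (hf : ContDiff ℝ ∞ f)
    (hR : ∀ z : ℝ × ℝ, R < |z.2| → f z = 0) (hne : ∃ z, f z ≠ 0) :
    ∃ z, fderiv ℝ f z (0, 1) ≠ 0 := by
  by_contra! h
  obtain ⟨⟨t, q⟩, hz⟩ := hne
  have hd : ∀ y, HasDerivAt (fun y => f (t, y)) 0 y := fun y => by
    have h1 : HasFDerivAt f (fderiv ℝ f (t, y)) (t, y) :=
      (hf.differentiable (by norm_num) _).hasFDerivAt
    have h2 : HasDerivAt (fun y : ℝ => (t, y)) ((0 : ℝ), (1 : ℝ)) y :=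
      (hasDerivAt_const y t).prodMk (hasDerivAt_id y)
    exact (h1.comp_hasDerivAt y h2).congr_deriv (h (t, y))
  have := is_const_of_deriv_eq_zero (fun y => (hd y).differentiableAt) (fun y => (hd y).deriv) q
    (|R| + 1)
  refine hz (this.trans (hR _ ?_))
  simp only
  rw [abs_of_nonneg (by positivity)]
  linarith [le_abs_self R]

/-- A compactly supported function on extended phase space with negative averaged second
variation. -/
theorem exists_integral_indexDensity_neg {C R : ℝ} (hf : ContDiff ℝ ∞ f)
    (hC : ∀ z : ℝ × ℝ, |f z| ≤ C * (1 + z.1 ^ 2)⁻¹) (hR0 : 0 ≤ R)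
    (hR : ∀ z : ℝ × ℝ, R < |z.2| → f z = 0) (hne : ∃ z, f z ≠ 0) :
    ∃ φ : ℝ × ℝ × ℝ → ℝ, ContDiff ℝ ∞ φ ∧ HasCompactSupport φ ∧ ∫ x, indexDensity f φ x < 0 := by
  obtain ⟨b, c, hb, hb0, hb1, hbone, hbone', hb2, hb2', hbc⟩ := exists_smooth_cutoff
  obtain ⟨A, hA⟩ := exists_integral_phaseCutoff_le hf hb hb0 hb1 hb2 hb2' hbc hC hR0 hR
  obtain ⟨z, hz⟩ := exists_forceDeriv_ne_zero hf hR hne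
  set F' : ℝ × ℝ × ℝ → ℝ := fun x => fderiv ℝ f (x.1, x.2.1) (0, 1) with hF'
  have hF'c : ContDiff ℝ ∞ F' := contDiff_forceDeriv hf
  let β : ContDiffBump ((z.1, z.2, 0) : ℝ × ℝ × ℝ) := default
  have hβ : ContDiff ℝ ∞ β := β.contDiff
  -- With this choice the cross term is `m = ∫ f_q² β > 0`.
  set ψ : ℝ × ℝ × ℝ → ℝ := fun x => F' x * β x with hψ
  have hψc : ContDiff ℝ ∞ ψ := hF'c.mul hβ
  have hψs : HasCompactSupport ψ := β.hasCompactSupport.mul_left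
  set m : ℝ := ∫ x, F' x * ψ x
  set B : ℝ := ∫ x, indexDensity f ψ x
  have hFψ : Integrable (fun x => F' x * ψ x) :=
    (hF'c.mul hψc).continuous.integrable_of_hasCompactSupport hψs.mul_left
  have hmpos : 0 < m := by
    refine (hF'c.mul hψc).continuous.integral_pos_of_hasCompactSupport_nonneg_nonzero
      hψs.mul_left (fun x => ?_) (x := (z.1, z.2, 0)) ?_
    · have := mul_nonneg (sq_nonneg (F' x)) (β.nonneg (x := x))
      simp only [hψ, Pi.zero_apply]
      nlinarith
    · have h1 : β (z.1, z.2, 0) = 1 := β.one_of_mem_closedBall (by simp [β.rIn_pos.le])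
      simp only [hψ, h1, mul_one, hF']
      exact mul_ne_zero hz hz
  obtain ⟨r, hr⟩ := hψs.isCompact.isBounded.subset_closedBall 0
  -- Small enough that the quadratic term `ε² B` uses up at most half of the gain `2 ε m`.
  set ε : ℝ := m / (|B| + 1) with hε
  have hBp : 0 < |B| + 1 := by positivity
  have hε0 : 0 < ε := by positivity
  have hεm : -2 * ε * m + ε ^ 2 * B ≤ -(ε * m) := by
    have h1 : ε * B ≤ m := by
      rw [hε, div_mul_eq_mul_div, div_le_iff₀ hBp]
      nlinarith [le_abs_self B]
    nlinarith
  -- The first summands put the support of `ψ` inside the plateau of the cutoff; the last one gives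
  -- `A / P < ε m`. Note that `ε` and `m` do not depend on `P`.
  set P : ℝ := |r| + 2 + |A| / (ε * m)
  have hεmp : 0 < ε * m := by positivity
  have hAdiv : 0 ≤ |A| / (ε * m) := by positivity
  have hP1 : 1 ≤ P := by have := abs_nonneg r; linarith
  have hP0 : 0 < P := by linarith
  have hrP : |r| + 1 < P := by linarith
  set φ₀ := phaseCutoff b P (P ^ 4) (P ^ 2) with hφ₀
  have hφ₀c : ContDiff ℝ ∞ φ₀ := contDiff_phaseCutoff hb _ _ _
  have hφ₀s : HasCompactSupport φ₀ :=
    hasCompactSupport_phaseCutoff hb2 hP0 (by positivity) (by positivity)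
  have hεψ : ContDiff ℝ ∞ (fun x => ε * ψ x) := contDiff_const.mul hψc
  have hsum : ContDiff ℝ ∞ (fun x => φ₀ x + ε * ψ x) := hφ₀c.add hεψ
  have hsums : HasCompactSupport (fun x => φ₀ x + ε * ψ x) := hφ₀s.add hψs.mul_left
  have hone : ∀ x ∈ tsupport ψ, φ₀ x = 1 ∧ ∀ v, fderiv ℝ φ₀ x v = 0 := by
    intro x hx
    have hxr : ‖x‖ ≤ |r| := (mem_closedBall_zero_iff.1 (hr hx)).trans (le_abs_self r)
    have ht : |x.1| ≤ |r| := (norm_fst_le x).trans hxr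
    have hq : |x.2.1| ≤ |r| := ((norm_fst_le x.2).trans (norm_snd_le x)).trans hxr
    have hp : |x.2.2| ≤ |r| := ((norm_snd_le x.2).trans (norm_snd_le x)).trans hxr
    have hr0 := abs_nonneg r
    have near : ∀ {u N : ℝ}, 0 < N → |u| < N → |u / N| < 1 := by
      intro u N hN h
      rwa [abs_div, abs_of_pos hN, div_lt_one hN]
    have hP4 : P ≤ P ^ 4 := le_self_pow₀ hP1 (by norm_num)
    have n1 : |x.2.2 / P| < 1 := near hP0 (by linarith)
    have n2 : |x.1 / P ^ 4| < 1 := near (by positivity) (by linarith)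
    have n3 : |(x.2.1 - x.2.2 * x.1) / P ^ 2| < 1 := by
      refine near (by positivity) ?_
      have h1 := abs_sub x.2.1 (x.2.2 * x.1)
      rw [abs_mul] at h1
      have h2 : |x.2.2| * |x.1| ≤ |r| * |r| := mul_le_mul hp ht (abs_nonneg _) hr0
      nlinarith
    constructor
    · simp only [hφ₀, phaseCutoff, hbone _ n1, hbone _ n2, hbone _ n3, mul_one]
    · intro v
      rw [hφ₀, fderiv_phaseCutoff hb]
      simp [hbone' _ n1, hbone' _ n2, hbone' _ n3]
  -- On the support of `ψ` one has `φ₀ = 1` and `dφ₀ = 0`, so the only cross term is `-2 ε f_q ψ`.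
  have hpt : ∀ x, indexDensity f (fun x => φ₀ x + ε * ψ x) x =
      indexDensity f φ₀ x + (-2 * ε) * (F' x * ψ x) + ε ^ 2 * indexDensity f ψ x := by
    intro x
    have hfd : ∀ v, fderiv ℝ (fun x => φ₀ x + ε * ψ x) x v =
        fderiv ℝ φ₀ x v + ε * fderiv ℝ ψ x v := by
      intro v
      have h1 := (hφ₀c.differentiable (by norm_num) x).hasFDerivAt.add
        ((hψc.differentiable (by norm_num) x).hasFDerivAt.const_mul ε)
      have h2 : fderiv ℝ (fun x => φ₀ x + ε * ψ x) x = fderiv ℝ φ₀ x + ε • fderiv ℝ ψ x :=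
        h1.fderiv
      rw [h2]; simp
    simp only [indexDensity, hfd]
    by_cases hx : x ∈ tsupport ψ
    · obtain ⟨h1, h2⟩ := hone x hx
      simp only [h1, h2, hF']
      ring
    · have h1 : ψ x = 0 := image_eq_zero_of_notMem_tsupport hx
      have h2 : fderiv ℝ ψ x = 0 := by
        by_contra h
        exact hx (support_fderiv_subset ℝ h)
      simp [h1, h2]
  refine ⟨_, hsum, hsums, ?_⟩
  have i0 : Integrable (indexDensity f φ₀) :=
    (contDiff_indexDensity hf hφ₀c).continuous.integrable_of_hasCompactSupport
      (hasCompactSupport_indexDensity hφ₀s)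
  have i2 : Integrable (indexDensity f ψ) :=
    (contDiff_indexDensity hf hψc).continuous.integrable_of_hasCompactSupport
      (hasCompactSupport_indexDensity hψs)
  have hint : ∫ x, indexDensity f (fun x => φ₀ x + ε * ψ x) x =
      (∫ x, indexDensity f φ₀ x) + (-2 * ε) * m + ε ^ 2 * B := by
    simp only [hpt]
    have i01 : Integrable (fun x => indexDensity f φ₀ x + (-2 * ε) * (F' x * ψ x)) :=
      i0.add (hFψ.const_mul _)
    rw [integral_add i01 (i2.const_mul _),
      integral_add i0 (hFψ.const_mul _), integral_const_mul, integral_const_mul]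
  rw [hint]
  have h1 := hA P hP1
  have h2 : A / P < ε * m := by
    rw [div_lt_iff₀ hP0]
    have h3 : |A| / (ε * m) < P := by have := abs_nonneg r; linarith
    rw [div_lt_iff₀ hεmp] at h3
    linarith [le_abs_self A]
  linarith

/-- A solution of Newton's equation with negative second variation. -/
theorem exists_newton_solution_unstable {K : ℝ≥0} {C R : ℝ} (hf : ContDiff ℝ ∞ f)
    (hK : LipschitzWith K f) (hC : ∀ z : ℝ × ℝ, |f z| ≤ C * (1 + z.1 ^ 2)⁻¹) (hR0 : 0 ≤ R)
    (hR : ∀ z : ℝ × ℝ, R < |z.2| → f z = 0) (hne : ∃ z, f z ≠ 0) :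
    ∃ w y : ℝ → ℝ, ContDiff ℝ ∞ w ∧ ContDiff ℝ ∞ y ∧ HasCompactSupport y ∧
      (∀ t, deriv (deriv w) t = -f (t, w t)) ∧
      ∫ t, (deriv y t ^ 2 - fderiv ℝ f (t, w t) (0, 1) * y t ^ 2) < 0 := by
  have hX := lipschitzWith_newtonField hK
  have hC' : ∀ z, |f z| ≤ C := fun z => by
    have hC0 : 0 ≤ C := by
      have := (abs_nonneg _).trans (hC 0)
      simpa using this
    refine (hC z).trans (mul_le_of_le_one_right hC0 ?_)
    exact inv_le_one_of_one_le₀ (by nlinarith [sq_nonneg z.1])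
  have hXc := contDiff_newtonField hf
  obtain ⟨Ψ, hΨ⟩ := exists_isGlobalFlow hX (hXc.of_le (by norm_num))
  obtain ⟨φ, hφ, hφs, hneg⟩ := exists_integral_indexDensity_neg hf hC hR0 hR hne
  obtain ⟨x, hx⟩ : ∃ x, ∫ s, indexDensity f φ (Ψ s x) < 0 := by
    by_contra! h
    exact not_le.2 hneg (hΨ.newton_integral_nonneg hK hC'
      ((contDiff_indexDensity hf hφ).of_le (by norm_num)) (hasCompactSupport_indexDensity hφs) h)
  -- Shifting the flow parameter makes it agree with the time coordinate.
  set γ : ℝ → ℝ × ℝ × ℝ := fun t => Ψ (t - x.1) x with hγ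
  have hγc : ContDiff ℝ ∞ γ :=
    (hΨ.contDiff_curve hXc x).comp (contDiff_id.sub contDiff_const)
  have hγt : ∀ t, (γ t).1 = t := fun t => by simp [hγ, hΨ.newton_time]
  have hγd : ∀ t, HasDerivAt γ (newtonField f (γ t)) t := fun t =>
    (hΨ.hasDerivAt x (t - x.1)).comp_sub_const t x.1
  have hw : ∀ t, HasDerivAt (fun t => (γ t).2.1) (γ t).2.2 t := fun t =>
    (hΨ.newton_hasDerivAt_pos x (t - x.1)).comp_sub_const t x.1
  have hp : ∀ t, HasDerivAt (fun t => (γ t).2.2) (-f (t, (γ t).2.1)) t := fun t => by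
    have := (hΨ.newton_hasDerivAt_momentum x (t - x.1)).comp_sub_const t x.1
    refine this.congr_deriv ?_
    change -f ((γ t).1, (γ t).2.1) = _
    rw [hγt]
  have hy : ∀ t, HasDerivAt (fun t => φ (γ t)) (fderiv ℝ φ (γ t) (newtonField f (γ t))) t :=
    fun t => (hφ.differentiable (by norm_num) _).hasFDerivAt.comp_hasDerivAt t (hγd t)
  refine ⟨fun t => (γ t).2.1, fun t => φ (γ t), hγc.snd.fst, hφ.comp hγc, ?_, ?_, ?_⟩
  · refine HasCompactSupport.intro (hφs.isCompact.image continuous_fst) fun t ht => ?_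
    exact image_eq_zero_of_notMem_tsupport fun h => ht ⟨γ t, h, hγt t⟩
  · intro t
    have : deriv (fun t => (γ t).2.1) = fun t => (γ t).2.2 := funext fun t => (hw t).deriv
    rw [this, (hp t).deriv]
  · rw [← integral_sub_right_eq_self _ x.1] at hx
    refine lt_of_eq_of_lt (integral_congr_ae (ae_of_all _ fun t => ?_)) hx
    change _ = indexDensity f φ (γ t)
    simp only [(hy t).deriv, indexDensity, hγt]

end

/-! ### From negative second variation to smaller action -/

theorem le_of_le_second_deriv {u u' u'' : ℝ → ℝ} {s m : ℝ} (hs : 0 ≤ s)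
    (hu : ∀ τ, HasDerivAt u (u' τ) τ) (hu' : ∀ τ, HasDerivAt u' (u'' τ) τ)
    (hm : ∀ τ ∈ Icc 0 s, m ≤ u'' τ) : u 0 + u' 0 * s + m * s ^ 2 / 2 ≤ u s := by
  have h1 : MonotoneOn (fun τ => u' τ - m * τ) (Icc 0 s) := by
    have hd : ∀ τ, HasDerivAt (fun τ => u' τ - m * τ) (u'' τ - m) τ := fun τ =>
      ((hu' τ).sub ((hasDerivAt_id τ).const_mul m)).congr_deriv (by simp)
    refine monotoneOn_of_deriv_nonneg (convex_Icc 0 s)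
      (fun τ _ => (hd τ).continuousAt.continuousWithinAt)
      (fun τ _ => (hd τ).differentiableAt.differentiableWithinAt) fun τ hτ => ?_
    rw [(hd τ).deriv]
    linarith [hm τ (interior_subset hτ)]
  have h2 : MonotoneOn (fun τ => u τ - u' 0 * τ - m * τ ^ 2 / 2) (Icc 0 s) := by
    have hd : ∀ τ, HasDerivAt (fun τ => u τ - u' 0 * τ - m * τ ^ 2 / 2) (u' τ - u' 0 - m * τ) τ :=
      fun τ => (((hu τ).sub ((hasDerivAt_id τ).const_mul (u' 0))).sub
        ((((hasDerivAt_id τ).pow 2).const_mul m).div_const 2)).congr_deriv (by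
          simp only [id, mul_one]; norm_num; ring)
    refine monotoneOn_of_deriv_nonneg (convex_Icc 0 s)
      (fun τ _ => (hd τ).continuousAt.continuousWithinAt)
      (fun τ _ => (hd τ).differentiableAt.differentiableWithinAt) fun τ hτ => ?_
    rw [(hd τ).deriv]
    have hτ' := interior_subset hτ
    have := h1 (left_mem_Icc.2 hs) hτ' hτ'.1
    simp only [mul_zero, sub_zero] at this
    linarith
  have := h2 (left_mem_Icc.2 hs) (right_mem_Icc.2 hs) hs
  simp only [mul_zero, sub_zero, ne_eq, OfNat.ofNat_ne_zero, not_false_eq_true, zero_pow,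
    zero_div] at this
  linarith

/-- A negative second variation lowers the action of a solution of Newton's equation. -/
theorem eventually_action_lt {W f : ℝ × ℝ → ℝ} (hW : Continuous W) (hf : ContDiff ℝ ∞ f)
    (hWf : ∀ t q, HasDerivAt (fun q => W (t, q)) (f (t, q)) q) {w y : ℝ → ℝ}
    (hw : ContDiff ℝ ∞ w) (hy : ContDiff ℝ ∞ y) (hwf : ∀ t, deriv (deriv w) t = -f (t, w t))
    {α β : ℝ} (hαβ : α < β) (hys : tsupport y ⊆ Ioo α β)
    (hQ : ∫ t, (deriv y t ^ 2 - fderiv ℝ f (t, w t) (0, 1) * y t ^ 2) < 0) :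
    ∀ᶠ s in 𝓝[>] (0 : ℝ),
      ∫ t in α..β, (1 / 2 * (deriv w t + s * deriv y t) ^ 2 - W (t, w t + s * y t)) <
      ∫ t in α..β, (1 / 2 * deriv w t ^ 2 - W (t, w t)) := by
  set f' : ℝ × ℝ → ℝ := fun z => fderiv ℝ f z (0, 1) with hf'
  have hf'c : Continuous f' :=
    ((hf.fderiv_right (m := ∞) (by norm_num)).clm_apply contDiff_const).continuous
  have hff' : ∀ t q, HasDerivAt (fun q => f (t, q)) (f' (t, q)) q := fun t q => by
    have h1 : HasFDerivAt f (fderiv ℝ f (t, q)) (t, q) :=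
      (hf.differentiable (by norm_num) _).hasFDerivAt
    have h2 : HasDerivAt (fun y : ℝ => (t, y)) ((0 : ℝ), (1 : ℝ)) q :=
      (hasDerivAt_const q t).prodMk (hasDerivAt_id q)
    exact h1.comp_hasDerivAt q h2
  have hwc := hw.continuous
  have hyc := hy.continuous
  have hfc := hf.continuous
  have hw' : ContDiff ℝ ∞ (deriv w) := (contDiff_infty_iff_deriv.1 hw).2
  have hw'c := hw'.continuous
  have hy'c : Continuous (deriv y) := hy.continuous_deriv (by norm_num)
  have hw1 : ∀ t, HasDerivAt w (deriv w t) t := fun t =>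
    (hw.differentiable (by norm_num) t).hasDerivAt
  have hw2 : ∀ t, HasDerivAt (deriv w) (-f (t, w t)) t := fun t => by
    rw [← hwf]; exact (hw'.differentiable (by norm_num) t).hasDerivAt
  have hy1 : ∀ t, HasDerivAt y (deriv y t) t := fun t =>
    (hy.differentiable (by norm_num) t).hasDerivAt
  have hyα : y α = 0 := image_eq_zero_of_notMem_tsupport fun h => (hys h).1.false
  have hyβ : y β = 0 := image_eq_zero_of_notMem_tsupport fun h => (hys h).2.false
  -- The first variation vanishes: by Newton's equation the integrand is the derivative of `w' y`,
  -- and `y` vanishes at both ends.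
  have first : ∫ t in α..β, (deriv w t * deriv y t - f (t, w t) * y t) = 0 := by
    have hd : ∀ t ∈ uIcc α β, HasDerivAt (fun t => deriv w t * y t)
        (deriv w t * deriv y t - f (t, w t) * y t) t := fun t _ =>
      ((hw2 t).mul (hy1 t)).congr_deriv (by ring)
    rw [intervalIntegral.integral_eq_sub_of_hasDerivAt hd
      (Continuous.intervalIntegrable (by fun_prop) _ _), hyα, hyβ]
    simp
  set Q := ∫ t, (deriv y t ^ 2 - f' (t, w t) * y t ^ 2)
  have hQ' : ∫ t in α..β, (deriv y t ^ 2 - f' (t, w t) * y t ^ 2) = Q := by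
    refine intervalIntegral.integral_eq_integral_of_support_subset fun t ht => ?_
    refine Ioo_subset_Ioc_self (hys ?_)
    by_contra h
    refine ht ?_
    have h1 : y t = 0 := image_eq_zero_of_notMem_tsupport h
    have h2 : deriv y t = 0 := by
      by_contra h3
      exact h (support_deriv_subset h3)
    simp [h1, h2]
  -- Tolerance for the Taylor remainder: its integral is `-Q / 2`, so the second-order coefficient
  -- stays at most `Q / 2 < 0`.
  set η : ℝ := -Q / (2 * (β - α)) with hη
  have hη0 : 0 < η := div_pos (neg_pos.2 hQ) (by linarith)
  have huc : ∀ᶠ s in 𝓝 (0 : ℝ), ∀ t ∈ Icc α β,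
      f' (t, w t) * y t ^ 2 - η < f' (t, w t + s * y t) * y t ^ 2 := by
    refine isCompact_Icc.eventually_forall_of_forall_eventually fun t _ => ?_
    have hl : Continuous fun z : ℝ × ℝ => f' (z.2, w z.2) * y z.2 ^ 2 - η := by fun_prop
    have hr : Continuous fun z : ℝ × ℝ => f' (z.2, w z.2 + z.1 * y z.2) * y z.2 ^ 2 := by fun_prop
    refine (isOpen_lt hl hr).mem_nhds ?_
    change f' (t, w t) * y t ^ 2 - η < f' (t, w t + 0 * y t) * y t ^ 2
    rw [zero_mul, add_zero]
    linarith
  obtain ⟨δ, hδ, hball⟩ := Metric.eventually_nhds_iff.1 huc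
  have hmem : Ioo (0 : ℝ) δ ∈ 𝓝[>] (0 : ℝ) := Ioo_mem_nhdsGT hδ
  filter_upwards [hmem] with s hs
  have hpt : ∀ t ∈ Icc α β, 1 / 2 * (deriv w t + s * deriv y t) ^ 2 - W (t, w t + s * y t) ≤
      (1 / 2 * deriv w t ^ 2 - W (t, w t)) + s * (deriv w t * deriv y t - f (t, w t) * y t) +
        s ^ 2 / 2 * (deriv y t ^ 2 - f' (t, w t) * y t ^ 2 + η) := by
    intro t ht
    have hlin : ∀ τ, HasDerivAt (fun τ => w t + τ * y t) (y t) τ := fun τ => by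
      simpa using ((hasDerivAt_id τ).mul_const (y t)).const_add (w t)
    have := le_of_le_second_deriv (u := fun τ => W (t, w t + τ * y t))
      (u' := fun τ => f (t, w t + τ * y t) * y t)
      (u'' := fun τ => f' (t, w t + τ * y t) * y t * y t) (m := f' (t, w t) * y t ^ 2 - η) hs.1.le
      (fun τ => (hWf t _).comp τ (hlin τ))
      (fun τ => ((hff' t _).comp τ (hlin τ)).mul_const (y t))
      (fun τ hτ => by
        have := hball (y := τ) (by
          rw [Real.dist_eq, sub_zero, abs_of_nonneg hτ.1]; exact hτ.2.trans_lt hs.2) t ht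
        rw [mul_assoc, ← sq]; exact this.le)
    simp only [zero_mul, add_zero] at this
    nlinarith
  refine (intervalIntegral.integral_mono_on hαβ.le
    (Continuous.intervalIntegrable (by fun_prop) _ _)
    (Continuous.intervalIntegrable (by fun_prop) _ _) hpt).trans_lt ?_
  rw [intervalIntegral.integral_add (Continuous.intervalIntegrable (by fun_prop) _ _)
    (Continuous.intervalIntegrable (by fun_prop) _ _),
    intervalIntegral.integral_add (Continuous.intervalIntegrable (by fun_prop) _ _)
    (Continuous.intervalIntegrable (by fun_prop) _ _),
    intervalIntegral.integral_const_mul, intervalIntegral.integral_const_mul, first,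
    intervalIntegral.integral_add (Continuous.intervalIntegrable (by fun_prop) _ _)
    (Continuous.intervalIntegrable (by fun_prop) _ _), hQ', intervalIntegral.integral_const]
  have e : (β - α) • η = -Q / 2 := by
    rw [hη, smul_eq_mul]
    have : β - α ≠ 0 := by linarith
    field_simp
  rw [e]
  have := pow_pos hs.1 2
  nlinarith

/-! ### The radial equation in logarithmic time -/

/-- A unit vector of the plane. -/
noncomputable def axis : Plane := EuclideanSpace.single 0 1

theorem norm_smul_axis (r : ℝ) : ‖r • axis‖ = |r| := by
  simp [axis, norm_smul]

/-- The potential of the radial equation in logarithmic time. -/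
noncomputable def radialPotential (V : ℝ → Plane → ℝ) (z : ℝ × ℝ) : ℝ :=
  Real.exp z.1 ^ 2 * V z.2 (Real.exp z.1 • axis)

/-- The force of the radial equation in logarithmic time. -/
noncomputable def radialForce (V : ℝ → Plane → ℝ) (z : ℝ × ℝ) : ℝ :=
  Real.exp z.1 ^ 2 * fderiv ℝ (fun q : ℝ × Plane => V q.1 q.2) (z.2, Real.exp z.1 • axis) (1, 0)

section

variable {V : ℝ → Plane → ℝ}

theorem hasDerivAt_potential (hV : ContDiff ℝ ∞ (fun q : ℝ × Plane => V q.1 q.2)) (s : ℝ)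
    (x : Plane) : HasDerivAt (fun s => V s x)
      (fderiv ℝ (fun q : ℝ × Plane => V q.1 q.2) (s, x) (1, 0)) s := by
  have h1 := (hV.differentiable (by norm_num) (s, x)).hasFDerivAt
  have h2 : HasDerivAt (fun y : ℝ => (y, x)) ((1 : ℝ), (0 : Plane)) s :=
    (hasDerivAt_id s).prodMk (hasDerivAt_const s x)
  exact h1.comp_hasDerivAt s h2

theorem continuous_radialPotential (hV : ContDiff ℝ ∞ (fun q : ℝ × Plane => V q.1 q.2)) :
    Continuous (radialPotential V) := by
  have := hV.continuous.comp (f := fun z : ℝ × ℝ => (z.2, Real.exp z.1 • axis)) (by fun_prop)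
  simp only [Function.comp_def] at this
  unfold radialPotential
  fun_prop

theorem hasDerivAt_radialPotential (hV : ContDiff ℝ ∞ (fun q : ℝ × Plane => V q.1 q.2)) (t q : ℝ) :
    HasDerivAt (fun q => radialPotential V (t, q)) (radialForce V (t, q)) q :=
  (hasDerivAt_potential hV q (Real.exp t • axis)).const_mul (Real.exp t ^ 2)

theorem contDiff_radialForce (hV : ContDiff ℝ ∞ (fun q : ℝ × Plane => V q.1 q.2)) :
    ContDiff ℝ ∞ (radialForce V) := by
  have h1 : ContDiff ℝ ∞ (fun z => fderiv ℝ (fun q : ℝ × Plane => V q.1 q.2) z (1, 0)) :=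
    (hV.fderiv_right (m := ∞) (by norm_num)).clm_apply contDiff_const
  have h2 : ContDiff ℝ ∞ (fun z : ℝ × ℝ => (z.2, Real.exp z.1 • axis)) := by fun_prop
  have h3 : ContDiff ℝ ∞ (fun z : ℝ × ℝ => Real.exp z.1 ^ 2) := by fun_prop
  exact h3.mul (h1.comp h2)

/-- The radial force as a compactly supported function of position and radius. -/
theorem exists_radialForce_eq_comp (hV : ContDiff ℝ ∞ (fun q : ℝ × Plane => V q.1 q.2))
    (hVs : HasCompactSupport (fun q : ℝ × Plane => V q.1 q.2)) :
    ∃ k : ℝ × ℝ → ℝ, ContDiff ℝ ∞ k ∧ HasCompactSupport k ∧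
      ∀ t q, radialForce V (t, q) = Real.exp t ^ 2 * k (Real.exp t, q) := by
  have h1 : ContDiff ℝ ∞ (fun z => fderiv ℝ (fun q : ℝ × Plane => V q.1 q.2) z (1, 0)) :=
    (hV.fderiv_right (m := ∞) (by norm_num)).clm_apply contDiff_const
  have h2 : ContDiff ℝ ∞ (fun z : ℝ × ℝ => (z.2, z.1 • axis)) := by fun_prop
  refine ⟨fun z => fderiv ℝ (fun q : ℝ × Plane => V q.1 q.2) (z.2, z.1 • axis) (1, 0),
    h1.comp h2, ?_, fun t q => rfl⟩
  obtain ⟨R, hR⟩ := hVs.isCompact.isBounded.subset_closedBall 0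
  refine HasCompactSupport.intro (isCompact_closedBall (0 : ℝ × ℝ) R) fun z hz => ?_
  have : fderiv ℝ (fun q : ℝ × Plane => V q.1 q.2) (z.2, z.1 • axis) = 0 := by
    by_contra h
    have h3 := mem_closedBall_zero_iff.1 (hR (support_fderiv_subset ℝ h))
    refine hz (mem_closedBall_zero_iff.2 ?_)
    rw [Prod.norm_def, norm_smul_axis, max_comm] at h3
    exact h3
  rw [this]; rfl

/-- For `t ≤ 0` the exponential beats `1 + t²`; for `t ≥ 0` the bound `e^t ≤ R` confines `t` to a
bounded interval. This supplies the decay in `t` used in the averaging. -/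
theorem exp_sq_mul_le {t R : ℝ} (hR : Real.exp t ≤ R) :
    Real.exp t ^ 2 ≤ (1 + R ^ 2 * (1 + R ^ 2)) * (1 + t ^ 2)⁻¹ := by
  rw [← div_eq_mul_inv, le_div_iff₀ (by positivity)]
  have he := Real.exp_pos t
  rcases le_total t 0 with ht | ht
  · have h1 : 1 + t ^ 2 ≤ Real.exp (-t) ^ 2 := by
      have := Real.quadratic_le_exp_of_nonneg (neg_nonneg.2 ht)
      have h2 : 1 + -t ≤ Real.exp (-t) := by nlinarith
      nlinarith
    have h2 : Real.exp t ^ 2 * Real.exp (-t) ^ 2 = 1 := by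
      rw [← mul_pow, ← Real.exp_add]; simp
    have h3 := mul_le_mul_of_nonneg_left h1 (sq_nonneg (Real.exp t))
    nlinarith [sq_nonneg R, mul_nonneg (sq_nonneg R) (sq_nonneg R)]
  · have h1 : t ≤ R := by linarith [Real.add_one_le_exp t]
    have h2 : t ^ 2 ≤ R ^ 2 := by gcongr
    have h3 : Real.exp t ^ 2 ≤ R ^ 2 := by gcongr
    have h4 : Real.exp t ^ 2 * (1 + t ^ 2) ≤ R ^ 2 * (1 + R ^ 2) := by gcongr
    linarith

theorem exists_radialForce_bounds (hV : ContDiff ℝ ∞ (fun q : ℝ × Plane => V q.1 q.2))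
    (hVs : HasCompactSupport (fun q : ℝ × Plane => V q.1 q.2)) :
    ∃ (K : ℝ≥0) (C R : ℝ), LipschitzWith K (radialForce V) ∧
      (∀ z : ℝ × ℝ, |radialForce V z| ≤ C * (1 + z.1 ^ 2)⁻¹) ∧ 0 ≤ R ∧
      ∀ z : ℝ × ℝ, R < |z.2| → radialForce V z = 0 := by
  obtain ⟨k, hk, hks, hfk⟩ := exists_radialForce_eq_comp hV hVs
  obtain ⟨R, hR0, hR⟩ : ∃ R, 0 ≤ R ∧ ∀ z : ℝ × ℝ, R < ‖z‖ → k z = 0 := by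
    obtain ⟨R, hR⟩ := hks.isCompact.isBounded.subset_closedBall 0
    refine ⟨|R|, abs_nonneg R, fun z hz => image_eq_zero_of_notMem_tsupport fun h => ?_⟩
    have := mem_closedBall_zero_iff.1 (hR h)
    linarith [le_abs_self R]
  obtain ⟨c, hc⟩ := hk.continuous.bounded_above_of_compact_support hks
  have hc0 : 0 ≤ c := (norm_nonneg _).trans (hc 0)
  set h : ℝ × ℝ → ℝ := fun z => z.1 ^ 2 * k z
  have hhc : ContDiff ℝ ∞ h := (contDiff_fst.pow 2).mul hk
  have hhs : HasCompactSupport h := hks.mul_left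
  -- The weight `1 + |r|` absorbs the chain rule factor `e^t` of the substitution `r = e^t`, giving
  -- a global Lipschitz constant.
  obtain ⟨N, hN⟩ : ∃ N, ∀ z : ℝ × ℝ, ‖(1 + |z.1|) * ‖fderiv ℝ h z‖‖ ≤ N := by
    refine Continuous.bounded_above_of_compact_support ?_ ?_
    · have := (hhc.fderiv_right (m := ∞) (by norm_num)).continuous
      fun_prop
    · have h1 : HasCompactSupport fun z => ‖fderiv ℝ h z‖ := (hhs.fderiv ℝ).norm
      exact h1.mul_left
  have hN0 : 0 ≤ N := (norm_nonneg _).trans (hN 0)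
  have hfh : radialForce V = fun z => h (Real.exp z.1, z.2) := funext fun z => hfk z.1 z.2
  refine ⟨N.toNNReal, c * (1 + R ^ 2 * (1 + R ^ 2)), R, ?_, ?_, hR0, ?_⟩
  · refine lipschitzWith_of_nnnorm_fderiv_le
      ((contDiff_radialForce hV).differentiable (by norm_num)) fun z => ?_
    rw [← NNReal.coe_le_coe, coe_nnnorm, Real.coe_toNNReal _ hN0]
    have h1 : HasFDerivAt (fun z : ℝ × ℝ => (Real.exp z.1, z.2))
        ((Real.exp z.1 • ContinuousLinearMap.fst ℝ ℝ ℝ).prod (ContinuousLinearMap.snd ℝ ℝ ℝ)) z :=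
      (HasFDerivAt.exp (ContinuousLinearMap.fst ℝ ℝ ℝ).hasFDerivAt).prodMk
        (ContinuousLinearMap.snd ℝ ℝ ℝ).hasFDerivAt
    have h2 : HasFDerivAt (radialForce V) ((fderiv ℝ h (Real.exp z.1, z.2)).comp
        ((Real.exp z.1 • ContinuousLinearMap.fst ℝ ℝ ℝ).prod
          (ContinuousLinearMap.snd ℝ ℝ ℝ))) z := by
      rw [hfh]
      exact (hhc.differentiable (by norm_num) (Real.exp z.1, z.2)).hasFDerivAt.comp z h1
    rw [h2.fderiv]
    refine le_trans ?_ (hN (Real.exp z.1, z.2))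
    rw [norm_mul, norm_norm, mul_comm]
    refine (ContinuousLinearMap.opNorm_comp_le _ _).trans ?_
    refine mul_le_mul_of_nonneg_left ?_ (norm_nonneg _)
    have he := Real.exp_pos z.1
    refine ContinuousLinearMap.opNorm_le_bound _ (norm_nonneg _) fun v => ?_
    simp only [ContinuousLinearMap.prod_apply, smul_apply,
      ContinuousLinearMap.coe_fst', ContinuousLinearMap.coe_snd', smul_eq_mul, Real.norm_eq_abs,
      abs_of_pos he, Prod.norm_def, abs_mul, abs_of_pos (by linarith : 0 < 1 + Real.exp z.1)]
    have hv1 : |v.1| ≤ max |v.1| |v.2| := le_max_left _ _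
    have hv2 : |v.2| ≤ max |v.1| |v.2| := le_max_right _ _
    have hv0 := abs_nonneg v.1
    refine max_le ?_ ?_ <;> nlinarith
  · rintro ⟨t, q⟩
    rw [hfk]
    by_cases ht : Real.exp t ≤ R
    · rw [abs_mul, abs_of_pos (by positivity : 0 < Real.exp t ^ 2)]
      calc Real.exp t ^ 2 * |k (Real.exp t, q)|
          ≤ ((1 + R ^ 2 * (1 + R ^ 2)) * (1 + t ^ 2)⁻¹) * c := by
            have := exp_sq_mul_le ht
            have := hc (Real.exp t, q)
            rw [Real.norm_eq_abs] at this
            gcongr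
        _ = _ := by ring
    · have : k (Real.exp t, q) = 0 := by
        refine hR _ ((not_le.1 ht).trans_le ?_)
        exact (le_abs_self _).trans (norm_fst_le (Real.exp t, q))
      rw [this, mul_zero, abs_zero]
      positivity
  · rintro ⟨t, q⟩ hq
    rw [hfk, hR _ (lt_of_lt_of_le hq (norm_snd_le (Real.exp t, q))), mul_zero]

/-- If the force vanishes, `V` is constant in `u` for each `x ≠ 0`, hence zero there by compact
support. Logarithmic time does not see the origin, where continuity is used. -/
theorem exists_radialForce_ne_zero (hV : ContDiff ℝ ∞ (fun q : ℝ × Plane => V q.1 q.2))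
    (hVs : HasCompactSupport (fun q : ℝ × Plane => V q.1 q.2))
    (hVr : ∀ (s : ℝ) (x y : Plane), ‖x‖ = ‖y‖ → V s x = V s y)
    (hne : ∃ (s : ℝ) (x : Plane), V s x ≠ 0) : ∃ z, radialForce V z ≠ 0 := by
  by_contra! h
  obtain ⟨s, x, hx⟩ := hne
  have hzero : ∀ y : Plane, y ≠ 0 → V s y = 0 := by
    intro y hy
    have hpos : 0 < ‖y‖ := norm_pos_iff.2 hy
    set e : Plane := Real.exp (Real.log ‖y‖) • axis with he
    have hd : ∀ q, HasDerivAt (fun q => V q e) 0 q := fun q => by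
      have h1 := h (Real.log ‖y‖, q)
      simp only [radialForce, mul_eq_zero, pow_eq_zero_iff, ne_eq, OfNat.ofNat_ne_zero,
        not_false_eq_true, Real.exp_ne_zero, false_or] at h1
      rw [← h1]
      exact hasDerivAt_potential hV q e
    obtain ⟨R, hR⟩ := hVs.isCompact.isBounded.subset_closedBall 0
    have hc := is_const_of_deriv_eq_zero (fun q => (hd q).differentiableAt)
      (fun q => (hd q).deriv) s (|R| + 1)
    have hye : ‖y‖ = ‖e‖ := by
      rw [he, norm_smul_axis, Real.exp_log hpos, abs_of_pos hpos]
    rw [hVr s y e hye, hc]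
    by_contra hne
    have hmem : ((|R| + 1, e) : ℝ × Plane) ∈ tsupport (fun q : ℝ × Plane => V q.1 q.2) :=
      subset_tsupport _ hne
    have h2 := (norm_fst_le _).trans (mem_closedBall_zero_iff.1 (hR hmem))
    rw [Real.norm_eq_abs, abs_of_pos (by positivity)] at h2
    linarith [le_abs_self R]
  have hc : Continuous fun y => V s y :=
    hV.continuous.comp (continuous_const.prodMk continuous_id)
  have hcl : closure ({0}ᶜ : Set Plane) ⊆ {y | V s y = 0} :=
    closure_minimal (fun y hy => hzero y hy) (isClosed_eq hc continuous_const)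
  rw [closure_compl_singleton] at hcl
  exact hx (hcl (mem_univ x))

end

/-! ### Calculus of radial functions in logarithmic coordinates -/

/-- The function `ζ(log |x|)` on the plane. -/
noncomputable def logRadial (ζ : ℝ → ℝ) (x : Plane) : ℝ := ζ (Real.log ‖x‖)

theorem contDiffOn_logRadial {ζ : ℝ → ℝ} (hζ : ContDiff ℝ ∞ ζ) :
    ContDiffOn ℝ ∞ (logRadial ζ) {0}ᶜ := fun x hx =>
  (hζ.contDiffAt.comp x ((contDiffAt_norm ℝ hx).log (norm_ne_zero_iff.2 hx))).contDiffWithinAt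

theorem hasFDerivAt_logRadial {ζ : ℝ → ℝ} {ζ' : ℝ} {x : Plane} (hx : x ≠ 0)
    (hζ : HasDerivAt ζ ζ' (Real.log ‖x‖)) :
    HasFDerivAt (logRadial ζ) ((ζ' * (‖x‖ ^ 2)⁻¹) • innerSL ℝ x) x := by
  have hn : ‖x‖ ^ 2 ≠ 0 := by simpa using hx
  have h1 : HasFDerivAt (fun y : Plane => 1 / 2 * Real.log (‖y‖ ^ 2))
      ((1 / 2 : ℝ) • (‖x‖ ^ 2)⁻¹ • (2 • innerSL ℝ x)) x :=
    ((hasStrictFDerivAt_norm_sq x).hasFDerivAt.log hn).const_mul (1 / 2)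
  have h2 : (fun y : Plane => 1 / 2 * Real.log (‖y‖ ^ 2)) = fun y => Real.log ‖y‖ := by
    funext y
    rw [Real.log_pow]; push_cast; ring
  rw [h2] at h1
  have h3 := hζ.comp_hasFDerivAt x h1
  refine h3.congr_fderiv ?_
  ext v
  simp
  ring

theorem norm_gradient_logRadial {ζ : ℝ → ℝ} (hζ : Differentiable ℝ ζ) {x : Plane} (hx : x ≠ 0) :
    ‖gradient (logRadial ζ) x‖ ^ 2 = deriv ζ (Real.log ‖x‖) ^ 2 * (‖x‖ ^ 2)⁻¹ := by
  have hn : ‖x‖ ≠ 0 := norm_ne_zero_iff.2 hx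
  rw [gradient, LinearIsometryEquiv.norm_map,
    (hasFDerivAt_logRadial hx (hζ _).hasDerivAt).fderiv, norm_smul, innerSL_apply_norm, mul_pow,
    Real.norm_eq_abs, sq_abs]
  field_simp

theorem laplacian_logRadial {ζ : ℝ → ℝ} (hζ : ContDiff ℝ ∞ ζ) {x : Plane} (hx : x ≠ 0) :
    (Δ (logRadial ζ)) x = deriv (deriv ζ) (Real.log ‖x‖) * (‖x‖ ^ 2)⁻¹ := by
  have hζ' : ContDiff ℝ ∞ (deriv ζ) := (contDiff_infty_iff_deriv.1 hζ).2
  have hn : ‖x‖ ≠ 0 := norm_ne_zero_iff.2 hx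
  -- The gradient is `k(log |x|) x`, so the first-derivative formula can be applied a second time,
  -- to `k`.
  set k : ℝ → ℝ := fun t => deriv ζ t * Real.exp (-2 * t) with hk
  have hexp : ∀ y : Plane, y ≠ 0 → Real.exp (-2 * Real.log ‖y‖) = (‖y‖ ^ 2)⁻¹ := by
    intro y hy
    rw [show -2 * Real.log ‖y‖ = -(Real.log ‖y‖ + Real.log ‖y‖) by ring, Real.exp_neg,
      Real.exp_add, Real.exp_log (norm_pos_iff.2 hy), sq]
  have hkd : HasDerivAt k ((deriv (deriv ζ) (Real.log ‖x‖) - 2 * deriv ζ (Real.log ‖x‖)) *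
      (‖x‖ ^ 2)⁻¹) (Real.log ‖x‖) := by
    have h1 := (hζ'.differentiable (by norm_num) (Real.log ‖x‖)).hasDerivAt.mul
      ((hasDerivAt_id (Real.log ‖x‖)).const_mul (-2)).exp
    refine h1.congr_deriv ?_
    simp only [id, hexp x hx]
    ring
  have hev : fderiv ℝ (logRadial ζ) =ᶠ[𝓝 x] fun y => logRadial k y • innerSL ℝ y := by
    filter_upwards [isOpen_compl_singleton.mem_nhds hx] with y hy
    rw [(hasFDerivAt_logRadial hy (hζ.differentiable (by norm_num) _).hasDerivAt).fderiv]
    simp only [logRadial, hk, hexp y hy]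
  have h2 : HasFDerivAt (fun y : Plane => logRadial k y • innerSL ℝ y) _ x :=
    (hasFDerivAt_logRadial hx hkd).smul (innerSL ℝ (E := Plane)).hasFDerivAt
  have h3 := h2.congr_of_eventuallyEq hev
  rw [InnerProductSpace.laplacian_eq_iteratedFDeriv_orthonormalBasis _
    (EuclideanSpace.basisFun (Fin 2) ℝ)]
  simp only [iteratedFDeriv_two_apply, h3.fderiv]
  have hnorm : ‖x‖ ^ 2 = x 0 ^ 2 + x 1 ^ 2 := by
    rw [EuclideanSpace.norm_sq_eq]; simp
  have hk0 : logRadial k x = deriv ζ (Real.log ‖x‖) * (‖x‖ ^ 2)⁻¹ := by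
    simp only [logRadial, hk, hexp x hx]
  have hi : ∀ i, inner ℝ x (EuclideanSpace.single i (1 : ℝ)) = x i := fun i => by
    rw [EuclideanSpace.inner_single_right]; simp
  have hs : ∀ i, innerSL ℝ (EuclideanSpace.single i (1 : ℝ) : Plane)
      (EuclideanSpace.single i (1 : ℝ)) = 1 := fun i => by
    change inner ℝ (EuclideanSpace.single i (1 : ℝ) : Plane) (EuclideanSpace.single i (1 : ℝ)) = 1
    rw [EuclideanSpace.inner_single_right]; simp
  simp [Fin.sum_univ_two, hk0, hi, hs]
  field_simp
  rw [hnorm]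
  ring

/-! ### Annuli and the energy of radial functions -/

/-- The annulus `{a < |x| < b}`. -/
def annulus (a b : ℝ) : Set Plane := {x | a < ‖x‖ ∧ ‖x‖ < b}

theorem isOpen_annulus (a b : ℝ) : IsOpen (annulus a b) :=
  (isOpen_lt continuous_const continuous_norm).inter (isOpen_lt continuous_norm continuous_const)

theorem closure_annulus_subset (a b : ℝ) : closure (annulus a b) ⊆ {x | a ≤ ‖x‖ ∧ ‖x‖ ≤ b} :=
  closure_minimal (fun _ hx => ⟨hx.1.le, hx.2.le⟩)
    ((isClosed_le continuous_const continuous_norm).inter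
      (isClosed_le continuous_norm continuous_const))

theorem norm_eq_of_mem_frontier_annulus {a b : ℝ} {x : Plane} (hx : x ∈ frontier (annulus a b)) :
    ‖x‖ = a ∨ ‖x‖ = b := by
  rw [(isOpen_annulus a b).frontier_eq] at hx
  obtain ⟨h1, h2⟩ := closure_annulus_subset a b hx.1
  by_contra! h
  exact hx.2 ⟨lt_of_le_of_ne h1 (Ne.symm h.1), lt_of_le_of_ne h2 h.2⟩

theorem isSmoothBoundedDomain_annulus {a b : ℝ} (ha : 0 < a) (hab : a < b) :
    IsSmoothBoundedDomain (annulus a b) := by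
  have hsq : ContDiff ℝ ∞ (fun y : Plane => ‖y‖ ^ 2) := contDiff_norm_sq ℝ
  have hne : ∀ x : Plane, x ≠ 0 → (2 • innerSL ℝ x : Plane →L[ℝ] ℝ) ≠ 0 := by
    intro x hx h
    have := congrArg (fun l : Plane →L[ℝ] ℝ => l x) h
    simp at this
    exact hx this
  refine ⟨isOpen_annulus a b, ?_, ?_, ?_⟩
  · have h1 : IsConnected (Ioo a b ×ˢ Metric.sphere (0 : Plane) 1) :=
      (isConnected_Ioo hab).prod (isConnected_sphere (by
        rw [← Module.finrank_eq_rank]; simp) 0 zero_le_one)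
    have h2 : annulus a b = (fun z : ℝ × Plane => z.1 • z.2) ''
        (Ioo a b ×ˢ Metric.sphere (0 : Plane) 1) := by
      ext x
      constructor
      · intro hx
        have hpos : 0 < ‖x‖ := ha.trans hx.1
        refine ⟨(‖x‖, ‖x‖⁻¹ • x), ⟨hx, ?_⟩, ?_⟩
        · rw [mem_sphere_zero_iff_norm, norm_smul, norm_inv, norm_norm, inv_mul_cancel₀ hpos.ne']
        · simp only [smul_smul, mul_inv_cancel₀ hpos.ne', one_smul]
      · rintro ⟨⟨r, y⟩, ⟨hr, hy⟩, rfl⟩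
        rw [mem_sphere_zero_iff_norm] at hy
        simp only at hy
        have : ‖r • y‖ = r := by
          rw [norm_smul, hy, mul_one, Real.norm_eq_abs, abs_of_pos (ha.trans hr.1)]
        exact ⟨by rw [this]; exact hr.1, by rw [this]; exact hr.2⟩
    rw [h2]
    exact h1.image _ (by fun_prop)
  · exact (Metric.isBounded_ball (x := (0 : Plane)) (r := b)).subset
      fun x hx => mem_ball_zero_iff.2 hx.2
  · intro x hx
    rcases norm_eq_of_mem_frontier_annulus hx with h | h
    · refine ⟨{y | ‖y‖ < b}, fun y => a ^ 2 - ‖y‖ ^ 2,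
        isOpen_lt continuous_norm continuous_const, by simpa [h] using hab,
        (contDiff_const.sub hsq).contDiffOn, ?_, ?_⟩
      · have := ((hasStrictFDerivAt_norm_sq x).hasFDerivAt.const_sub (a ^ 2)).fderiv
        rw [this, neg_ne_zero]
        exact hne x (norm_pos_iff.1 (by rw [h]; exact ha))
      · ext y
        simp only [annulus, mem_inter_iff, mem_ofPred_eq, sub_neg,
          sq_lt_sq₀ ha.le (norm_nonneg y)]
        tauto
    · refine ⟨{y | a < ‖y‖}, fun y => ‖y‖ ^ 2 - b ^ 2,
        isOpen_lt continuous_const continuous_norm, by simpa [h] using hab,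
        (hsq.sub contDiff_const).contDiffOn, ?_, ?_⟩
      · have := ((hasStrictFDerivAt_norm_sq x).hasFDerivAt.sub_const (b ^ 2)).fderiv
        rw [this]
        exact hne x (norm_pos_iff.1 (by rw [h]; exact ha.trans hab))
      · ext y
        simp only [annulus, mem_inter_iff, mem_ofPred_eq, sub_neg,
          sq_lt_sq₀ (norm_nonneg y) (ha.trans hab).le]
        tauto

/-- The energy of a radial function on an annulus in logarithmic time. -/
theorem exists_energy_logRadial_eq {V : ℝ → Plane → ℝ}
    (hV : ContDiff ℝ ∞ (fun q : ℝ × Plane => V q.1 q.2))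
    (hVr : ∀ (s : ℝ) (x y : Plane), ‖x‖ = ‖y‖ → V s x = V s y) {α β : ℝ} (hαβ : α ≤ β) :
    ∃ κ : ℝ, 0 < κ ∧ ∀ ζ : ℝ → ℝ, ContDiff ℝ ∞ ζ →
      energy V (annulus (Real.exp α) (Real.exp β)) (logRadial ζ) =
        κ * ∫ t in α..β, (1 / 2 * deriv ζ t ^ 2 - radialPotential V (t, ζ t)) := by
  -- The length `2π` of the unit circle, expressed as twice the area of the disc.
  refine ⟨2 * volume.real (Metric.ball (0 : Plane) 1), ?_, fun ζ hζ => ?_⟩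
  · have : 0 < volume.real (Metric.ball (0 : Plane) 1) :=
      ENNReal.toReal_pos (Metric.measure_ball_pos _ _ one_pos).ne' measure_ball_lt_top.ne
    positivity
  set F : ℝ → ℝ := fun r => 1 / 2 * (deriv ζ (Real.log r) ^ 2 * (r ^ 2)⁻¹) -
    V (ζ (Real.log r)) (r • axis) with hF
  have hζc := hζ.continuous
  have hζ'c : Continuous (deriv ζ) := hζ.continuous_deriv (by norm_num)
  have hpos : ∀ r ∈ Ioo (Real.exp α) (Real.exp β), 0 < r := fun r hr => (Real.exp_pos α).trans hr.1
  have h1 : energy V (annulus (Real.exp α) (Real.exp β)) (logRadial ζ) =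
      ∫ x : Plane, (Ioo (Real.exp α) (Real.exp β)).indicator F ‖x‖ := by
    rw [energy, ← integral_indicator (isOpen_annulus _ _).measurableSet]
    refine integral_congr_ae (ae_of_all _ fun x => ?_)
    by_cases hx : x ∈ annulus (Real.exp α) (Real.exp β)
    · have hx' : ‖x‖ ∈ Ioo (Real.exp α) (Real.exp β) := hx
      have hx0 : x ≠ 0 := norm_pos_iff.1 (hpos _ hx')
      simp only [indicator_of_mem hx, indicator_of_mem hx',
        norm_gradient_logRadial (hζ.differentiable (by norm_num)) hx0, hF, logRadial]
      rw [hVr _ x (‖x‖ • axis) (by rw [norm_smul_axis, abs_norm])]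
    · have hx' : ‖x‖ ∉ Ioo (Real.exp α) (Real.exp β) := hx
      simp only [indicator_of_notMem hx, indicator_of_notMem hx']
  have h2 : ∫ x : Plane, (Ioo (Real.exp α) (Real.exp β)).indicator F ‖x‖ =
      2 * volume.real (Metric.ball (0 : Plane) 1) *
        ∫ r in (Real.exp α)..(Real.exp β), r * F r := by
    rw [integral_fun_norm_addHaar volume, finrank_euclideanSpace_fin, nsmul_eq_mul, smul_eq_mul,
      mul_assoc, intervalIntegral.integral_of_le (Real.exp_le_exp.2 hαβ),
      integral_Ioc_eq_integral_Ioo]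
    push_cast
    congr 2
    rw [← integral_indicator measurableSet_Ioi, ← integral_indicator measurableSet_Ioo]
    refine integral_congr_ae (ae_of_all _ fun r => ?_)
    by_cases hr : r ∈ Ioo (Real.exp α) (Real.exp β)
    · simp [indicator_of_mem hr, indicator_of_mem (show r ∈ Ioi (0 : ℝ) from hpos r hr)]
    · by_cases hr0 : r ∈ Ioi (0 : ℝ)
      · simp [indicator_of_notMem hr]
      · simp [indicator_of_notMem hr, indicator_of_notMem hr0]
  rw [h1, h2]
  congr 1
  -- Substituting `r = e^t`, the Jacobian `r dr = e^{2t} dt` cancels the factor `r⁻²` of the squared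
  -- gradient and turns `V` into the radial potential.
  have h3 := intervalIntegral.integral_comp_mul_deriv' (a := α) (b := β) (f := Real.exp)
    (f' := Real.exp) (g := fun r => r * F r) (fun t _ => Real.hasDerivAt_exp t)
    Real.continuous_exp.continuousOn (by
      have hsub : Real.exp '' uIcc α β ⊆ {0}ᶜ := by
        rintro _ ⟨t, _, rfl⟩
        exact (Real.exp_pos t).ne'
      have hlog : ContinuousOn Real.log (Real.exp '' uIcc α β) := Real.continuousOn_log.mono hsub
      have hinv : ContinuousOn (fun r : ℝ => (r ^ 2)⁻¹) (Real.exp '' uIcc α β) :=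
        (continuous_pow 2).continuousOn.inv₀ fun r hr => pow_ne_zero 2 (hsub hr)
      have hVc : ContinuousOn (fun r : ℝ => V (ζ (Real.log r)) (r • axis))
          (Real.exp '' uIcc α β) := by
        have : ContinuousOn (fun r : ℝ => (ζ (Real.log r), r • axis)) (Real.exp '' uIcc α β) :=
          (hζc.comp_continuousOn hlog).prodMk (by fun_prop)
        exact hV.continuous.comp_continuousOn this
      exact continuousOn_id.mul ((continuousOn_const.mul
        (((hζ'c.comp_continuousOn hlog).pow 2).mul hinv)).sub hVc))
  rw [← h3]
  refine intervalIntegral.integral_congr fun t _ => ?_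
  have he := Real.exp_pos t
  simp only [hF, Function.comp_apply, Real.log_exp, radialPotential]
  field_simp

/-! ### Failure of local minimality -/

theorem not_isGloballyMinimising_of_not_isLocallyMinimal {V : ℝ → Plane → ℝ} {Ω : Set Plane}
    {u : Plane → ℝ} (h : ¬ IsLocallyMinimal V Ω u) : ¬ IsGloballyMinimising V Ω u := fun hg =>
  h fun D hD hDΩ => ⟨0, 1, one_pos, fun v hv _ => hg D hD hDΩ v hv⟩

theorem exists_norm_iteratedFDeriv_le {φ : Plane → ℝ} (hφ : ContDiffOn ℝ ∞ φ {0}ᶜ)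
    {S : Set Plane} (hS : IsCompact S) (hS0 : S ⊆ {0}ᶜ) (k : ℕ) :
    ∃ N : ℝ, 0 ≤ N ∧ ∀ j ≤ k, ∀ x ∈ S, ‖iteratedFDeriv ℝ j φ x‖ ≤ N := by
  have key : ∀ j : ℕ, ∃ N : ℝ, ∀ x ∈ S, ‖iteratedFDeriv ℝ j φ x‖ ≤ N := fun j =>
    hS.exists_bound_of_continuousOn fun x hx =>
      ((hφ.contDiffAt (isOpen_compl_singleton.mem_nhds (hS0 hx))).continuousAt_iteratedFDeriv
        (by exact_mod_cast le_top)).continuousWithinAt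
  choose N hN using key
  refine ⟨∑ j ∈ Finset.range (k + 1), |N j|, Finset.sum_nonneg fun _ _ => abs_nonneg _,
    fun j hj x hx => (hN j x hx).trans ((le_abs_self _).trans ?_)⟩
  exact Finset.single_le_sum (f := fun j => |N j|) (fun _ _ => abs_nonneg _)
    (Finset.mem_range.2 (Nat.lt_succ_of_le hj))

theorem exists_radial_solution_not_isLocallyMinimal {V : ℝ → Plane → ℝ}
    (hV_smooth : ContDiff ℝ ∞ (fun q : ℝ × Plane => V q.1 q.2))
    (hV_supp : HasCompactSupport (fun q : ℝ × Plane => V q.1 q.2))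
    (hV_radial : ∀ (s : ℝ) (x y : Plane), ‖x‖ = ‖y‖ → V s x = V s y)
    (hV_ne : ∃ (s : ℝ) (x : Plane), V s x ≠ 0) :
    ∃ u : Plane → ℝ, (∀ x y : Plane, ‖x‖ = ‖y‖ → u x = u y) ∧ IsSolution V {0}ᶜ u ∧
      ¬ IsLocallyMinimal V {0}ᶜ u := by
  obtain ⟨K, C, R, hK, hC, hR0, hR⟩ := exists_radialForce_bounds hV_smooth hV_supp
  have hf := contDiff_radialForce hV_smooth
  obtain ⟨w, y, hw, hy, hys, hwf, hQ⟩ := exists_newton_solution_unstable hf hK hC hR0 hR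
    (exists_radialForce_ne_zero hV_smooth hV_supp hV_radial hV_ne)
  have hloc : ¬ IsLocallyMinimal V {0}ᶜ (logRadial w) := by
    intro hmin
    obtain ⟨ρ, hρ, hsub⟩ : ∃ ρ : ℝ, 0 < ρ ∧ tsupport y ⊆ Ioo (-ρ) ρ := by
      obtain ⟨r, hr⟩ := hys.isCompact.isBounded.subset_closedBall 0
      refine ⟨|r| + 1, by positivity, fun t ht => abs_lt.1 ?_⟩
      have := mem_closedBall_zero_iff.1 (hr ht)
      rw [Real.norm_eq_abs] at this
      linarith [le_abs_self r]
    have hρ' : -ρ < ρ := by linarith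
    -- The annulus corresponds to the time interval `(-ρ, ρ)`, which contains the support of `y`;
    -- hence the variation vanishes on the boundary.
    have hD := isSmoothBoundedDomain_annulus (Real.exp_pos (-ρ)) (Real.exp_lt_exp.2 hρ')
    have hcl0 : closure (annulus (Real.exp (-ρ)) (Real.exp ρ)) ⊆ {0}ᶜ := fun x hx hx0 => by
      have := (closure_annulus_subset _ _ hx).1
      rw [mem_singleton_iff.1 hx0, norm_zero] at this
      exact (Real.exp_pos _).not_ge this
    obtain ⟨k, ε, hε, hle⟩ := hmin _ hD hcl0
    obtain ⟨κ, hκ, hen⟩ := exists_energy_logRadial_eq hV_smooth hV_radial hρ'.le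
    have hφ := contDiffOn_logRadial hy
    -- The competitor differs from `u` by `s` times a fixed function, so its derivatives up to order
    -- `k` differ by at most `s N`, for any prescribed `k`.
    obtain ⟨N, hN0, hN⟩ := exists_norm_iteratedFDeriv_le hφ hD.isBounded.isCompact_closure hcl0 k
    have hsmall : ∀ᶠ s in 𝓝[>] (0 : ℝ), s * N < ε := by
      refine nhdsWithin_le_nhds ?_
      have : Continuous fun s : ℝ => s * N := by fun_prop
      exact this.tendsto 0 |>.eventually (gt_mem_nhds (by simpa using hε))
    obtain ⟨s, hs, hsN, hs0⟩ := ((eventually_action_lt (continuous_radialPotential hV_smooth) hf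
      (hasDerivAt_radialPotential hV_smooth) hw hy hwf hρ' hsub hQ).and
        (hsmall.and self_mem_nhdsWithin)).exists
    have hs0' : (0 : ℝ) < s := hs0
    set ζ : ℝ → ℝ := fun t => w t + s * y t with hζ
    have hζc : ContDiff ℝ ∞ ζ := hw.add (contDiff_const.mul hy)
    have hζ' : ∀ t, deriv ζ t = deriv w t + s * deriv y t := fun t =>
      ((hw.differentiable (by norm_num) t).hasDerivAt.add
        ((hy.differentiable (by norm_num) t).hasDerivAt.const_mul s)).deriv
    refine (hle (logRadial ζ) ⟨⟨{0}ᶜ, isOpen_compl_singleton, hcl0, contDiffOn_logRadial hζc⟩,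
      fun x hx => ?_⟩ fun j hj x hx => ?_).not_gt ?_
    · have hy0 : y (Real.log ‖x‖) = 0 := by
        refine image_eq_zero_of_notMem_tsupport fun h => ?_
        rcases norm_eq_of_mem_frontier_annulus hx with h' | h' <;> rw [h', Real.log_exp] at h
        · exact (hsub h).1.false
        · exact (hsub h).2.false
      simp [logRadial, hζ, hy0]
    · have hdiff : (fun z => logRadial ζ z - logRadial w z) = s • logRadial y := by
        funext z
        simp [logRadial, hζ]
      have hx0 : x ∈ ({0}ᶜ : Set Plane) := hcl0 (subset_closure hx)
      rw [hdiff, iteratedFDeriv_const_smul_apply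
        ((hφ.contDiffAt (isOpen_compl_singleton.mem_nhds hx0)).of_le (by exact_mod_cast le_top)),
        norm_smul, Real.norm_eq_abs, abs_of_pos hs0']
      exact (mul_le_mul_of_nonneg_left (hN j hj x (subset_closure hx)) hs0'.le).trans_lt hsN
    · rw [hen ζ hζc, hen w hw]
      refine mul_lt_mul_of_pos_left ?_ hκ
      simpa only [hζ'] using hs
  refine ⟨logRadial w, fun x y hxy => by simp only [logRadial, hxy],
    ⟨contDiffOn_logRadial hw, fun x hx => ?_⟩, hloc⟩
  have hpos : 0 < ‖x‖ := norm_pos_iff.2 hx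
  rw [laplacian_logRadial hw hx, hwf]
  have hVx : (fun s => V s x) = fun s => V s (‖x‖ • axis) := funext fun s =>
    hV_radial s _ _ (by rw [norm_smul_axis, abs_norm])
  rw [hVx, (hasDerivAt_potential hV_smooth _ _).deriv]
  simp only [radialForce, Real.exp_log hpos, logRadial]
  field_simp

end EllipticRigidity

theorem theorem2
    (V : ℝ → EllipticRigidity.Plane → ℝ)
    (hV_smooth : ContDiff ℝ ∞ (fun q : ℝ × EllipticRigidity.Plane => V q.1 q.2))
    (hV_supp : HasCompactSupport (fun q : ℝ × EllipticRigidity.Plane => V q.1 q.2))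
    (hV_radial : ∀ (s : ℝ) (x y : EllipticRigidity.Plane), ‖x‖ = ‖y‖ → V s x = V s y)
    (hV_ne : ∃ (s : ℝ) (x : EllipticRigidity.Plane), V s x ≠ 0) :
    ∃ u : EllipticRigidity.Plane → ℝ,
      (∀ x y : EllipticRigidity.Plane, ‖x‖ = ‖y‖ → u x = u y) ∧
      EllipticRigidity.IsSolution V {0}ᶜ u ∧
      ¬ EllipticRigidity.IsGloballyMinimising V {0}ᶜ u ∧
      ¬ EllipticRigidity.IsLocallyMinimal V {0}ᶜ u := by
  obtain ⟨u, hu, hsol, hloc⟩ :=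
    EllipticRigidity.exists_radial_solution_not_isLocallyMinimal hV_smooth hV_supp hV_radial hV_ne
  exact ⟨u, hu, hsol,
    EllipticRigidity.not_isGloballyMinimising_of_not_isLocallyMinimal hloc, hloc⟩
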